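/- Let $d\ge 1$, let $\Omega\subset\mathbb{R}^d$ be open, let $1\le p<\infty$, and let $(\nu_\varepsilon)_{\varepsilon>0}$ be a family of radial measurable functions $\nu_\varepsilon:\mathbb{R}^d\setminus\{0\}\to[0,\infty]$ such that for every $\varepsilon>0$ and every $\delta>0$ $$\int_{\mathbb{R}^d}(1\wedge|h|^p)\,\nu_\varepsilon(h)\,dh=1,\qquad \lim_{\varepsilon\to0^+}\int_{|h|>\delta}(1\wedge|h|^p)\,\nu_\varepsilon(h)\,dh=0 .$$ For a unit vector $e\in\mathbb{R}^d$ put $K_{d,p}=\frac{1}{|\mathbb{S}^{d-1}|}\int_{\mathbb{S}^{d-1}}|w\cdot e|^p\,d\sigma_{d-1}(w)$, which does not depend on $e$. Functions are real-valued. Let $W^{1,p}(\Omega)$ be the space of $u\in L^p(\Omega)$ whose distributional gradient $\nabla u$ belongs to $L^p(\Omega)$, with norm $\|u\|_{W^{1,p}(\Omega)}=(\|u\|_{L^p(\Omega)}^p+\|\nabla u\|_{L^p(\Omega)}^p)^{1/p}$; put $\|\nabla u\|_{L^p(\Omega)}=\infty$ if $u$ has no distributional gradient in $L^p(\Omega)$.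 For $u\in L^1(\Omega)$ put $$|u|_{BV(\Omega)}=\sup\Big\{\int_\Omega u\,\operatorname{div}\phi\,dx:\ \phi\in C_c^\infty(\Omega,\mathbb{R}^d),\ |\phi|\le1\Big\}\in[0,\infty],$$ and let $BV(\Omega)=\{u\in L^1(\Omega):|u|_{BV(\Omega)}<\infty\}$, with norm $\|u\|_{BV(\Omega)}=\|u\|_{L^1(\Omega)}+|u|_{BV(\Omega)}$. For $v\in BV(\mathbb{R}^d)$ let $|\nabla v|$ be the total variation measure of its distributional gradient, that is, the Borel measure with $|\nabla v|(U)=|v|_{BV(U)}$ for every open $U$. The open set $\Omega$ is a $W^{1,p}$-extension domain if there are a linear operator $E:W^{1,p}(\Omega)\to W^{1,p}(\mathbb{R}^d)$ and a constant $C$ with $Eu|_\Omega=u$ and $\|Eu\|_{W^{1,p}(\mathbb{R}^d)}\le C\|u\|_{W^{1,p}(\Omega)}$ for all $u\in W^{1,p}(\Omega)$. It is a $BV$-extension domain if there are a linear operator $E:BV(\Omega)\to BV(\mathbb{R}^d)$ and a constant $C$ with $Eu|_\Omega=u$, $\|Eu\|_{BV(\mathbb{R}^d)}\le C\|u\|_{BV(\Omega)}$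 and $|\nabla Eu|(\partial\Omega)=0$ for all $u\in BV(\Omega)$. (1) Let $\Omega$ be a $W^{1,p}$-extension domain, and suppose that either $1<p<\infty$ and $u\in L^p(\Omega)$, or $p=1$ and $u\in W^{1,1}(\Omega)$. Then $$\limsup_{\varepsilon\to0^+}\int_\Omega\int_\Omega|u(x)-u(y)|^p\,\nu_\varepsilon(x-y)\,dy\,dx\ \le\ K_{d,p}\,\|\nabla u\|_{L^p(\Omega)}^p .$$ (2) Let $p=1$ and let $\Omega$ be a $BV$-extension domain. Then for every $u\in L^1(\Omega)$ $$\limsup_{\varepsilon\to0^+}\int_\Omega\int_\Omega|u(x)-u(y)|\,\nu_\varepsilon(x-y)\,dy\,dx\ \le\ K_{d,1}\,|u|_{BV(\Omega)} .$$ -/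

import Mathlib

open MeasureTheory Filter Topology Set
open scoped ENNReal NNReal ContDiff

noncomputable section

namespace BBM

/-- `ℝ^d` with its Euclidean norm and Lebesgue measure. -/
abbrev Rd (d : ℕ) : Type := EuclideanSpace ℝ (Fin d)

/-- The `i`-th standard unit vector of `ℝ^d`. -/
abbrev stdVec {d : ℕ} (i : Fin d) : Rd d := EuclideanSpace.single i (1 : ℝ)

/-! ### Kernels and the constant -/

/-- A family `(ν_ε)_{ε > 0}` of radial measurable functions on `ℝ^d ∖ {0}` with values in `[0, ∞]`
such that `∫ (1 ∧ |h|^p) ν_ε(h) dh = 1` and `∫_{|h| > δ} (1 ∧ |h|^p) ν_ε(h) dh → 0` as `ε → 0⁺`,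
for every `δ > 0`. The value of `ν_ε` at the origin is arbitrary and plays no role. -/
structure IsPLevyApprox {d : ℕ} (p : ℝ) (ν : ℝ → Rd d → ℝ≥0∞) : Prop where
  measurable : ∀ ε : ℝ, 0 < ε → AEMeasurable (ν ε) volume
  radial : ∀ ε : ℝ, 0 < ε → ∀ h k : Rd d, h ≠ 0 → ‖h‖ = ‖k‖ → ν ε h = ν ε k
  integral_eq_one : ∀ ε : ℝ, 0 < ε →
    ∫⁻ h, min 1 (‖h‖ₑ ^ p) * ν ε h = 1
  concentration : ∀ δ : ℝ, 0 < δ →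
    Tendsto (fun ε : ℝ => ∫⁻ h in {h : Rd d | δ < ‖h‖}, min 1 (‖h‖ₑ ^ p) * ν ε h)
      (𝓝[>] 0) (𝓝 0)

/-- The mean value over the unit sphere `⨍ |w · e|^p dσ(w)`, with respect to the surface measure.
For a unit vector `e` this is the constant `K_{d,p}`. -/
def sphereMean {d : ℕ} (e : Rd d) (p : ℝ) : ℝ≥0∞ :=
  ⨍⁻ w : Metric.sphere (0 : Rd d) 1, ‖inner ℝ (w : Rd d) e‖ₑ ^ p ∂(volume : Measure (Rd d)).toSphere

/-- The nonlocal energy `∬_{Ω × Ω} |u(x) - u(y)|^p ν(x - y) dy dx`. -/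
def nonlocalEnergy {d : ℕ} (p : ℝ) (ν : Rd d → ℝ≥0∞) (Ω : Set (Rd d)) (u : Rd d → ℝ) : ℝ≥0∞ :=
  ∫⁻ x in Ω, ∫⁻ y in Ω, ‖u x - u y‖ₑ ^ p * ν (x - y)

/-! ### The Sobolev space `W^{1,p}(Ω)` -/

/-- `g` is the distributional gradient, as a locally integrable function, of `u` on `Ω`. -/
structure IsWeakGrad {d : ℕ} (Ω : Set (Rd d)) (u : Rd d → ℝ) (g : Rd d → Rd d) : Prop where
  locInt : LocallyIntegrableOn u Ω volume
  locInt_grad : LocallyIntegrableOn g Ω volume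
  integral_eq : ∀ φ : Rd d → ℝ, ContDiff ℝ ∞ φ → HasCompactSupport φ → tsupport φ ⊆ Ω →
    ∀ i : Fin d, ∫ x in Ω, u x * fderiv ℝ φ x (stdVec i) = - ∫ x in Ω, g x i * φ x

/-- `‖∇u‖_{L^p(Ω)}^p = ∫_Ω |∇u|^p`, equal to `∞` if `u` has no distributional gradient in
`L^p(Ω)`. (The gradient is unique up to null sets, so the infimum ranges over at most one value.) -/
def gradEnergy {d : ℕ} (p : ℝ) (Ω : Set (Rd d)) (u : Rd d → ℝ) : ℝ≥0∞ :=
  ⨅ (g : Rd d → Rd d) (_ : IsWeakGrad Ω u g), ∫⁻ x in Ω, ‖g x‖ₑ ^ p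

/-- `u ∈ W^{1,p}(Ω)`, for a function `u` of which only the restriction to `Ω` matters. -/
def MemW1p {d : ℕ} (p : ℝ) (Ω : Set (Rd d)) (u : Rd d → ℝ) : Prop :=
  MemLp u (ENNReal.ofReal p) (volume.restrict Ω) ∧
    ∃ g : Rd d → Rd d, IsWeakGrad Ω u g ∧ MemLp g (ENNReal.ofReal p) (volume.restrict Ω)

/-- The norm `(‖u‖_{L^p(Ω)}^p + ‖∇u‖_{L^p(Ω)}^p)^{1/p}`. -/
def w1pNorm {d : ℕ} (p : ℝ) (Ω : Set (Rd d)) (u : Rd d → ℝ) : ℝ≥0∞ :=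
  (eLpNorm u (ENNReal.ofReal p) (volume.restrict Ω) ^ p + gradEnergy p Ω u) ^ (1 / p)

/-! ### The space `BV(Ω)` -/

/-- The divergence of a vector field on `ℝ^d`. -/
def divergence {d : ℕ} (φ : Rd d → Rd d) (x : Rd d) : ℝ :=
  ∑ i : Fin d, fderiv ℝ φ x (stdVec i) i

/-- The test fields `φ ∈ C_c^∞(Ω, ℝ^d)` with `|φ| ≤ 1`. -/
structure IsTestField {d : ℕ} (Ω : Set (Rd d)) (φ : Rd d → Rd d) : Prop where
  smooth : ContDiff ℝ ∞ φ
  compact : HasCompactSupport φ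
  support_subset : tsupport φ ⊆ Ω
  norm_le : ∀ x, ‖φ x‖ ≤ 1

/-- `|u|_{BV(Ω)} = sup {∫_Ω u div φ : φ ∈ C_c^∞(Ω, ℝ^d), |φ| ≤ 1}`. Since `φ = 0` is admissible,
nothing is lost by taking the positive part of the integral. -/
def bvSeminorm {d : ℕ} (Ω : Set (Rd d)) (u : Rd d → ℝ) : ℝ≥0∞ :=
  ⨆ (φ : Rd d → Rd d) (_ : IsTestField Ω φ), ENNReal.ofReal (∫ x in Ω, u x * divergence φ x)

/-- The norm `‖u‖_{L^1(Ω)} + |u|_{BV(Ω)}`. -/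
def bvNorm {d : ℕ} (Ω : Set (Rd d)) (u : Rd d → ℝ) : ℝ≥0∞ :=
  eLpNorm u 1 (volume.restrict Ω) + bvSeminorm Ω u

/-- The total variation measure `|∇u|` of `u ∈ BV(ℝ^d)`: its value is `|u|_{BV(U)}` on open sets `U`
and it is extended to arbitrary sets by outer regularity. -/
def variationMeasure {d : ℕ} (u : Rd d → ℝ) (A : Set (Rd d)) : ℝ≥0∞ :=
  ⨅ (U : Set (Rd d)) (_ : IsOpen U) (_ : A ⊆ U), bvSeminorm U u

/-! ### Both spaces as vector spaces of classes of functions -/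

section Helpers

variable {d : ℕ} {Ω : Set (Rd d)}

theorem integrable_mul_of_locInt {f ψ : Rd d → ℝ} (hf : LocallyIntegrableOn f Ω volume)
    (hψ : Continuous ψ) (hc : HasCompactSupport ψ) (hs : tsupport ψ ⊆ Ω) :
    Integrable (fun x => f x * ψ x) (volume.restrict Ω) := by
  have h1 : IntegrableOn f (tsupport ψ) volume :=
    hf.integrableOn_compact_subset hs hc
  have h2 : IntegrableOn (fun x => f x * ψ x) (tsupport ψ) volume :=
    h1.mul_continuousOn hψ.continuousOn hc
  have h3 : Integrable (fun x => f x * ψ x) volume := by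
    rwa [integrableOn_iff_integrable_of_support_subset] at h2
    intro x hx
    apply subset_tsupport
    intro h0
    exact hx (by simp [h0])
  exact h3.restrict

theorem continuous_partial {φ : Rd d → ℝ} (h : ContDiff ℝ ∞ φ) (v : Rd d) :
    Continuous (fun x => fderiv ℝ φ x v) :=
  (h.continuous_fderiv (by simp)).clm_apply continuous_const

theorem integrable_mul_partial {u φ : Rd d → ℝ} (hu : LocallyIntegrableOn u Ω volume)
    (h : ContDiff ℝ ∞ φ) (hc : HasCompactSupport φ) (hs : tsupport φ ⊆ Ω) (v : Rd d) :
    Integrable (fun x => u x * fderiv ℝ φ x v) (volume.restrict Ω) :=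
  integrable_mul_of_locInt hu (continuous_partial h v) (hc.fderiv_apply (𝕜 := ℝ) v)
    ((tsupport_fderiv_apply_subset ℝ v).trans hs)

theorem locInt_coord {g : Rd d → Rd d} (hg : LocallyIntegrableOn g Ω volume) (i : Fin d) :
    LocallyIntegrableOn (fun x => g x i) Ω volume :=
  (EuclideanSpace.proj (𝕜 := ℝ) i : Rd d →L[ℝ] ℝ).locallyIntegrableOn_comp hg

theorem IsWeakGrad.congr {u v : Rd d → ℝ} {g : Rd d → Rd d} (h : IsWeakGrad Ω u g)
    (huv : u =ᵐ[volume.restrict Ω] v) : IsWeakGrad Ω v g where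
  locInt := h.locInt.congr huv
  locInt_grad := h.locInt_grad
  integral_eq φ h1 h2 h3 i := by
    rw [← h.integral_eq φ h1 h2 h3 i]
    refine integral_congr_ae ?_
    filter_upwards [huv] with x hx
    rw [hx]

theorem IsWeakGrad.add {u v : Rd d → ℝ} {g k : Rd d → Rd d} (hu : IsWeakGrad Ω u g)
    (hv : IsWeakGrad Ω v k) : IsWeakGrad Ω (u + v) (g + k) where
  locInt := hu.locInt.add hv.locInt
  locInt_grad := hu.locInt_grad.add hv.locInt_grad
  integral_eq φ h1 h2 h3 i := by
    have e1 := integral_add (integrable_mul_partial hu.locInt h1 h2 h3 (stdVec i))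
      (integrable_mul_partial hv.locInt h1 h2 h3 (stdVec i))
    have e2 := integral_add (integrable_mul_of_locInt (locInt_coord hu.locInt_grad i)
      h1.continuous h2 h3) (integrable_mul_of_locInt (locInt_coord hv.locInt_grad i)
      h1.continuous h2 h3)
    simp only [Pi.add_apply, PiLp.add_apply, add_mul]
    rw [e1, e2, hu.integral_eq φ h1 h2 h3 i, hv.integral_eq φ h1 h2 h3 i]
    ring

theorem IsWeakGrad.smul {u : Rd d → ℝ} {g : Rd d → Rd d} (c : ℝ) (hu : IsWeakGrad Ω u g) :
    IsWeakGrad Ω (c • u) (c • g) where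
  locInt := hu.locInt.smul c
  locInt_grad := hu.locInt_grad.smul c
  integral_eq φ h1 h2 h3 i := by
    simp only [Pi.smul_apply, PiLp.smul_apply, smul_eq_mul, mul_assoc, integral_const_mul]
    rw [hu.integral_eq φ h1 h2 h3 i]
    ring

theorem isWeakGrad_zero : IsWeakGrad Ω (0 : Rd d → ℝ) (0 : Rd d → Rd d) where
  locInt := locallyIntegrableOn_zero
  locInt_grad := locallyIntegrableOn_zero
  integral_eq φ _ _ _ i := by simp

theorem continuous_divergence {φ : Rd d → Rd d} (h : ContDiff ℝ ∞ φ) :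
    Continuous (divergence φ) := by
  refine continuous_finsetSum _ fun i _ => ?_
  exact (EuclideanSpace.proj (𝕜 := ℝ) i : Rd d →L[ℝ] ℝ).continuous.comp
    ((h.continuous_fderiv (by simp)).clm_apply continuous_const)

theorem hasCompactSupport_divergence {φ : Rd d → Rd d} (hc : HasCompactSupport φ) :
    HasCompactSupport (divergence φ) := by
  refine (hc.fderiv (𝕜 := ℝ)).mono fun x hx h0 => hx ?_
  simp [divergence, h0]

theorem integrable_mul_divergence {u : Rd d → ℝ} (hu : MemLp u 1 (volume.restrict Ω))
    {φ : Rd d → Rd d} (hφ : IsTestField Ω φ) :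
    Integrable (fun x => u x * divergence φ x) (volume.restrict Ω) := by
  have hcont := continuous_divergence hφ.smooth
  obtain ⟨C, hC⟩ := (hasCompactSupport_divergence hφ.compact).exists_bound_of_continuous hcont
  exact (memLp_one_iff_integrable.1 hu).mul_bdd hcont.aestronglyMeasurable
    (Eventually.of_forall hC)

theorem bvSeminorm_congr {u v : Rd d → ℝ} (huv : u =ᵐ[volume.restrict Ω] v) :
    bvSeminorm Ω u = bvSeminorm Ω v := by
  have h : ∀ φ : Rd d → Rd d,
      ∫ x in Ω, u x * divergence φ x = ∫ x in Ω, v x * divergence φ x := by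
    intro φ
    refine integral_congr_ae ?_
    filter_upwards [huv] with x hx
    rw [hx]
  simp only [bvSeminorm, h]

theorem bvSeminorm_zero : bvSeminorm Ω (0 : Rd d → ℝ) = 0 := by
  simp [bvSeminorm]

theorem bvSeminorm_add_le {u v : Rd d → ℝ} (hu : MemLp u 1 (volume.restrict Ω))
    (hv : MemLp v 1 (volume.restrict Ω)) :
    bvSeminorm Ω (u + v) ≤ bvSeminorm Ω u + bvSeminorm Ω v := by
  refine iSup₂_le fun φ hφ => ?_
  simp only [Pi.add_apply, add_mul]
  rw [integral_add (integrable_mul_divergence hu hφ) (integrable_mul_divergence hv hφ)]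
  refine ENNReal.ofReal_add_le.trans (add_le_add ?_ ?_)
  · exact le_iSup₂ (f := fun (φ : Rd d → Rd d) (_ : IsTestField Ω φ) =>
      ENNReal.ofReal (∫ x in Ω, u x * divergence φ x)) φ hφ
  · exact le_iSup₂ (f := fun (φ : Rd d → Rd d) (_ : IsTestField Ω φ) =>
      ENNReal.ofReal (∫ x in Ω, v x * divergence φ x)) φ hφ

theorem IsTestField.neg {φ : Rd d → Rd d} (h : IsTestField Ω φ) :
    IsTestField Ω (fun x => - φ x) where
  smooth := h.smooth.neg
  compact := h.compact.comp_left (g := fun y : Rd d => -y) neg_zero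
  support_subset := by
    have h1 : Function.support (fun x => - φ x) = Function.support φ :=
      Function.support_fun_neg φ
    rw [tsupport, h1]
    exact h.support_subset
  norm_le x := by simpa using h.norm_le x

theorem divergence_neg (φ : Rd d → Rd d) (x : Rd d) :
    divergence (fun y => - φ y) x = - divergence φ x := by
  simp [divergence, fderiv_fun_neg]

theorem bvSeminorm_smul_le (c : ℝ) (u : Rd d → ℝ) :
    bvSeminorm Ω (c • u) ≤ ENNReal.ofReal |c| * bvSeminorm Ω u := by
  refine iSup₂_le fun φ hφ => ?_
  simp only [Pi.smul_apply, smul_eq_mul, mul_assoc, integral_const_mul]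
  rcases le_total 0 c with hc | hc
  · rw [ENNReal.ofReal_mul hc, abs_of_nonneg hc]
    gcongr
    exact le_iSup₂ (f := fun (φ : Rd d → Rd d) (_ : IsTestField Ω φ) =>
      ENNReal.ofReal (∫ x in Ω, u x * divergence φ x)) φ hφ
  · have h1 : c * ∫ x in Ω, u x * divergence φ x
        = (-c) * ∫ x in Ω, u x * divergence (fun y => - φ y) x := by
      simp only [divergence_neg, mul_neg, integral_neg]
      ring
    rw [h1, ENNReal.ofReal_mul (by linarith), abs_of_nonpos hc]
    gcongr
    exact le_iSup₂ (f := fun (φ : Rd d → Rd d) (_ : IsTestField Ω φ) =>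
      ENNReal.ofReal (∫ x in Ω, u x * divergence φ x)) (fun y => - φ y) hφ.neg

end Helpers

/-- The Sobolev space `W^{1,p}(Ω)` as a linear subspace of `L^p(Ω)`. -/
def W1p {d : ℕ} (p : ℝ) (Ω : Set (Rd d)) :
    Submodule ℝ (Lp ℝ (ENNReal.ofReal p) ((volume : Measure (Rd d)).restrict Ω)) where
  carrier := {f | MemW1p p Ω f}
  zero_mem' := ⟨Lp.memLp _, 0, isWeakGrad_zero.congr (Lp.coeFn_zero _ _ _).symm, MemLp.zero⟩
  add_mem' := by
    rintro f k ⟨_, g₁, h₁, h₁'⟩ ⟨_, g₂, h₂, h₂'⟩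
    exact ⟨Lp.memLp _, g₁ + g₂, (h₁.add h₂).congr (Lp.coeFn_add _ _).symm, h₁'.add h₂'⟩
  smul_mem' := by
    rintro c f ⟨_, g, h, h'⟩
    exact ⟨Lp.memLp _, c • g, (h.smul c).congr (Lp.coeFn_smul _ _).symm, h'.const_smul c⟩

/-- The space `BV(Ω)` as a linear subspace of `L^1(Ω)`. -/
def BV {d : ℕ} (Ω : Set (Rd d)) :
    Submodule ℝ (Lp ℝ 1 ((volume : Measure (Rd d)).restrict Ω)) where
  carrier := {f | bvSeminorm Ω f < ⊤}
  zero_mem' := by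
    simp only [mem_ofPred_eq]
    rw [bvSeminorm_congr (Lp.coeFn_zero _ _ _), bvSeminorm_zero]
    exact ENNReal.zero_lt_top
  add_mem' := by
    intro f k hf hk
    simp only [mem_ofPred_eq] at *
    rw [bvSeminorm_congr (Lp.coeFn_add _ _)]
    exact (bvSeminorm_add_le (Lp.memLp f) (Lp.memLp k)).trans_lt (ENNReal.add_lt_top.2 ⟨hf, hk⟩)
  smul_mem' := by
    intro c f hf
    simp only [mem_ofPred_eq] at *
    rw [bvSeminorm_congr (Lp.coeFn_smul _ _)]
    exact (bvSeminorm_smul_le c f).trans_lt (ENNReal.mul_lt_top ENNReal.ofReal_lt_top hf)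

/-! ### Extension domains -/

/-- `Ω` is a `W^{1,p}`-extension domain: `Ω` is open and there is a bounded linear extension operator
`W^{1,p}(Ω) → W^{1,p}(ℝ^d)`. -/
def IsW1pExtensionDomain {d : ℕ} (p : ℝ) (Ω : Set (Rd d)) : Prop :=
  IsOpen Ω ∧ ∃ (T : W1p p Ω →ₗ[ℝ] W1p p (univ : Set (Rd d))) (C : ℝ≥0), ∀ u : W1p p Ω,
    (T u).1 =ᵐ[volume.restrict Ω] u.1 ∧ w1pNorm p univ (T u).1 ≤ C * w1pNorm p Ω u.1

/-- `Ω` is a `BV`-extension domain: `Ω` is open and there is a bounded linear extension operator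
`BV(Ω) → BV(ℝ^d)` such that the variation measures of the extensions do not charge `∂Ω`. -/
def IsBVExtensionDomain {d : ℕ} (Ω : Set (Rd d)) : Prop :=
  IsOpen Ω ∧ ∃ (T : BV Ω →ₗ[ℝ] BV (univ : Set (Rd d))) (C : ℝ≥0), ∀ u : BV Ω,
    (T u).1 =ᵐ[volume.restrict Ω] u.1 ∧ bvNorm univ (T u).1 ≤ C * bvNorm Ω u.1 ∧
      variationMeasure (T u).1 (frontier Ω) = 0

end BBM

end

noncomputable section

namespace BBM

/-! ### Polar coordinates -/

section Polar

variable {d : ℕ}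

/-! Replace $u$ by its extension $v$ to $\mathbb{R}^d$; the energy on $\Omega$ does not see the
change. Enlarging the inner integral to $\mathbb{R}^d$ and putting $y=x+h$ bounds the energy by
$\int\nu_\varepsilon(h)\,\tau(h)\,dh$ with $\tau(h)=\int_\Omega|v(x+h)-v(x)|^p\,dx$. Since $\tau\le
2^p\|v\|_p^p$, the part $|h|>\delta$ vanishes in the limit by concentration, so any bound on the
part $|h|\le\delta$ that is uniform in $\varepsilon$, for one fixed $\delta$, bounds the limsup
(`limsup_nonlocalEnergy_le`).

The constant comes from polar coordinates: for radial $f$, $\int f(h)|h\cdot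
a|^p\,dh=K_{d,p}|a|^p\int f(h)|h|^p\,dh$ (`lintegral_radial_mul_inner`). With $f=\nu_\varepsilon
1_{|h|\le\delta}$ and $\delta\le1$ the last integral is at most 1.

Sobolev case: $v(x+h)-v(x)=\int_0^1 h\cdot g(x+th)\,dt$ for a.e. $x$, where $g=\nabla v$. Split off
$h\cdot g(x)$; by continuity of translations in $L^p$ the remainder has $p$-th power integral at
most $\eta|h|^p$, with $\eta$ small for small $\delta$. Convexity with weights $l+m=1$ separates the
two terms at the cost of $l^{1-p}$; then let $\eta\to0$ and $l\to1$. The main term is evaluated at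
$x\in\Omega$ itself, so $g$ is needed only on $\Omega$, where it is $\nabla u$.

BV case: mollify $v$ and use $\int_\Omega|w(x+h)-w(x)|\,dx\le\int_W|h\cdot\nabla w|$ for smooth $w$,
with $W$ a neighbourhood of $\Omega$. As $\int_W|\nabla w|\le|w|_{BV(W)}$ and mollification does not
increase the variation beyond that of $v$ on a slightly larger $W'$, Fatou gives the bound
$K_{d,1}|v|_{BV(W')}$ (`near_energy_le_bvSeminorm`). Shrinking $W'$ to $\Omega$ is possible because
$|\nabla v|$ does not charge $\partial\Omega$ (`exists_bvSeminorm_thickening_le`). -/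

theorem nontrivial_Rd {e : Rd d} (he : ‖e‖ = 1) : Nontrivial (Rd d) :=
  ⟨⟨e, 0, fun h => by simp [h] at he⟩⟩

/-- Polar coordinates for the product of a radial and a homogeneous function. -/
theorem lintegral_radial_mul_homogeneous {e : Rd d} (he : ‖e‖ = 1) {f : Rd d → ℝ≥0∞}
    (hf : AEMeasurable f volume) (hrad : ∀ h k : Rd d, h ≠ 0 → ‖h‖ = ‖k‖ → f h = f k) (p : ℝ)
    {Φ : Rd d → ℝ≥0∞} (hΦ : Measurable Φ)
    (hhom : ∀ (r : ℝ) (w : Rd d), 0 < r → Φ (r • w) = ENNReal.ofReal r ^ p * Φ w) :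
    ∫⁻ h, f h * Φ h = (∫⁻ w : Metric.sphere (0 : Rd d) 1, Φ w ∂(volume : Measure (Rd d)).toSphere) *
      ∫⁻ r : Ioi (0 : ℝ), f (r.1 • e) * ENNReal.ofReal r.1 ^ p
        ∂(Measure.volumeIoiPow (Module.finrank ℝ (Rd d) - 1)) := by
  have := nontrivial_Rd he
  set μ : Measure (Rd d) := volume
  have mp := μ.measurePreserving_homeomorphUnitSphereProd
  have emb := (homeomorphUnitSphereProd (Rd d)).measurableEmbedding
  have hfr : ∀ (w : Metric.sphere (0 : Rd d) 1) (r : Ioi (0 : ℝ)), f (r.1 • w.1) = f (r.1 • e) := by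
    intro w r
    have hr : (0 : ℝ) < r.1 := r.2
    refine hrad _ _ ?_ ?_
    · rw [smul_ne_zero_iff]
      exact ⟨hr.ne', ne_zero_of_mem_unit_sphere w⟩
    · have : ‖w.1‖ = 1 := by simp
      rw [norm_smul, norm_smul, he, this]
  -- A single ray is a null set when $d\ge2$, so a.e. measurability of `f` is carried to the
  -- product, where `f` depends on the radius alone; it descends to that factor because the sphere
  -- has nonzero measure.
  have hmeas : AEMeasurable (fun r : Ioi (0 : ℝ) => f (r.1 • e))
      (Measure.volumeIoiPow (Module.finrank ℝ (Rd d) - 1)) := by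
    have h1 : AEMeasurable (fun x : ({0}ᶜ : Set (Rd d)) => f x) (μ.comap (↑)) :=
      hf.comp_quasiMeasurePreserving
        ⟨measurable_subtype_coe, by
          rw [(MeasurableEmbedding.subtype_coe (measurableSet_singleton _).compl).map_comap]
          exact Measure.absolutelyContinuous_of_le Measure.restrict_le_self⟩
    have h2 := h1.comp_quasiMeasurePreserving (mp.symm
      (homeomorphUnitSphereProd (Rd d)).toMeasurableEquiv).quasiMeasurePreserving
    have h3 : AEMeasurable (fun q : Metric.sphere (0 : Rd d) 1 × Ioi (0 : ℝ) => f (q.2.1 • e))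
        (μ.toSphere.prod (Measure.volumeIoiPow (Module.finrank ℝ (Rd d) - 1))) := by
      refine h2.congr (Eventually.of_forall fun q => ?_)
      exact hfr q.1 q.2
    exact ((AEStronglyMeasurable.comp_snd_iff (Measure.toSphere_ne_zero μ)).1
      h3.aestronglyMeasurable).aemeasurable
  calc ∫⁻ h, f h * Φ h = ∫⁻ x : ({0}ᶜ : Set (Rd d)), f x * Φ x ∂(μ.comap (↑)) := by
        rw [lintegral_subtype_comap (measurableSet_singleton _).compl fun x => f x * Φ x,
          restrict_compl_singleton]
    _ = ∫⁻ q : Metric.sphere (0 : Rd d) 1 × Ioi (0 : ℝ),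
          Φ q.1 * (f (q.2.1 • e) * ENNReal.ofReal q.2.1 ^ p)
          ∂(μ.toSphere.prod (Measure.volumeIoiPow (Module.finrank ℝ (Rd d) - 1))) := by
        rw [← mp.lintegral_comp_emb emb]
        refine lintegral_congr fun x => ?_
        have hx : x.1 = ((homeomorphUnitSphereProd (Rd d) x).2).1 •
            ((homeomorphUnitSphereProd (Rd d) x).1).1 := by
          have hx0 : ‖x.1‖ ≠ 0 := norm_ne_zero_iff.2 x.2
          simp [smul_smul, hx0]
        conv_lhs => rw [hx]
        rw [hfr, hhom _ _ (homeomorphUnitSphereProd (Rd d) x).2.2]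
        ring
    _ = _ := lintegral_prod_mul (hΦ.comp measurable_subtype_coe).aemeasurable
        (hmeas.mul ((ENNReal.measurable_ofReal.comp
          measurable_subtype_coe).pow_const p).aemeasurable)

theorem enorm_inner_smul_rpow (a : Rd d) (p : ℝ) (hp : 0 ≤ p) (r : ℝ) (w : Rd d) (hr : 0 < r) :
    ‖inner ℝ (r • w) a‖ₑ ^ p = ENNReal.ofReal r ^ p * ‖inner ℝ w a‖ₑ ^ p := by
  rw [real_inner_smul_left, enorm_mul, ENNReal.mul_rpow_of_nonneg _ _ hp,
    Real.enorm_eq_ofReal hr.le]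

/-- The radial integral over the unit ball is finite and positive. -/
theorem radial_ball_integral {e : Rd d} (he : ‖e‖ = 1) (p : ℝ) (hp : 0 ≤ p) :
    ∃ R : ℝ≥0∞, R ≠ 0 ∧ R ≠ ⊤ ∧ ∀ a : Rd d,
      ∫⁻ h in Metric.ball (0 : Rd d) 1, ‖inner ℝ h a‖ₑ ^ p =
        (∫⁻ w : Metric.sphere (0 : Rd d) 1, ‖inner ℝ (w : Rd d) a‖ₑ ^ p
          ∂(volume : Measure (Rd d)).toSphere) * R := by
  have := nontrivial_Rd he
  set f : Rd d → ℝ≥0∞ := (Metric.ball (0 : Rd d) 1).indicator 1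
  have hf : Measurable f := measurable_one.indicator measurableSet_ball
  have hrad : ∀ h k : Rd d, h ≠ 0 → ‖h‖ = ‖k‖ → f h = f k := by
    intro h k _ hk
    simp [f, indicator, hk]
  have hmain := fun (Φ : Rd d → ℝ≥0∞) (hΦ : Measurable Φ) hhom =>
    lintegral_radial_mul_homogeneous he hf.aemeasurable hrad p (Φ := Φ) hΦ hhom
  have key : ∀ Φ : Rd d → ℝ≥0∞, ∫⁻ h, f h * Φ h = ∫⁻ h in Metric.ball (0 : Rd d) 1, Φ h := by
    intro Φ
    rw [← lintegral_indicator measurableSet_ball]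
    refine lintegral_congr fun h => ?_
    by_cases hh : h ∈ Metric.ball (0 : Rd d) 1 <;> simp [f, hh]
  -- The witness is the radial factor in the polar formula for the indicator of the ball.
  refine ⟨_, ?_, ?_, fun a => by
    rw [← key]
    exact hmain (fun h => ‖inner ℝ h a‖ₑ ^ p) (by fun_prop)
      fun r w hr => enorm_inner_smul_rpow a p hp r w hr⟩
  all_goals
    -- Testing with $|h|^p$ gives the area of the sphere times the radial factor, so the latter is
    -- neither zero nor infinite.
    have hn := hmain (fun h => ‖h‖ₑ ^ p) (by fun_prop) fun r w hr => by
      rw [enorm_smul, ENNReal.mul_rpow_of_nonneg _ _ hp, Real.enorm_eq_ofReal hr.le]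
    rw [key] at hn
    have hs : (∫⁻ w : Metric.sphere (0 : Rd d) 1, ‖(w : Rd d)‖ₑ ^ p
        ∂(volume : Measure (Rd d)).toSphere) = (volume : Measure (Rd d)).toSphere univ := by
      rw [← lintegral_one]
      refine lintegral_congr fun w => ?_
      have : ‖w.1‖ₑ = 1 := by rw [← ofReal_norm]; simp
      simp [this]
    rw [hs] at hn
  · intro h0
    rw [h0, mul_zero, lintegral_eq_zero_iff (by fun_prop)] at hn
    have h1 : ∀ᵐ h : Rd d ∂volume.restrict (Metric.ball 0 1), h ∈ ({0} : Set (Rd d)) := by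
      filter_upwards [hn] with h hh
      have := (ENNReal.rpow_eq_zero_iff.1 hh)
      simpa using this.resolve_right (by simp)|>.1
    rw [ae_iff, Measure.restrict_apply' measurableSet_ball] at h1
    have h2 : volume (Metric.ball (0 : Rd d) 1) = 0 := by
      refine le_antisymm ?_ zero_le
      calc volume (Metric.ball (0 : Rd d) 1) ≤ volume ({a : Rd d | a ∉ ({0} : Set (Rd d))} ∩
            Metric.ball 0 1 ∪ {0}) := by
            refine measure_mono fun x hx => ?_
            by_cases h : x = 0
            · exact Or.inr h
            · exact Or.inl ⟨h, hx⟩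
        _ ≤ _ := (measure_union_le _ _).trans (by rw [h1]; simp)
    exact (Metric.measure_ball_pos volume (0 : Rd d) one_pos).ne' h2
  · intro h0
    have hfin : ∫⁻ h in Metric.ball (0 : Rd d) 1, ‖h‖ₑ ^ p < ⊤ := by
      calc ∫⁻ h in Metric.ball (0 : Rd d) 1, ‖h‖ₑ ^ p ≤ ∫⁻ h in Metric.ball (0 : Rd d) 1, 1 := by
            refine setLIntegral_mono (by fun_prop) fun x hx => ?_
            refine ENNReal.rpow_le_one ?_ hp
            rw [← ofReal_norm, ENNReal.ofReal_le_one]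
            exact (mem_ball_zero_iff.1 hx).le
        _ < ⊤ := by simpa using measure_ball_lt_top
    rw [hn, h0, ENNReal.mul_top (Measure.measure_univ_ne_zero.2 (Measure.toSphere_ne_zero _))] at hfin
    exact lt_irrefl _ hfin

/-- The spherical integral of `|w · a|^p` is `|a|^p` times the one for a unit vector. -/
theorem lintegral_sphere_inner {e : Rd d} (he : ‖e‖ = 1) (p : ℝ) (hp : 0 < p) (a : Rd d) :
    (∫⁻ w : Metric.sphere (0 : Rd d) 1, ‖inner ℝ (w : Rd d) a‖ₑ ^ p
        ∂(volume : Measure (Rd d)).toSphere) =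
      ‖a‖ₑ ^ p * ∫⁻ w : Metric.sphere (0 : Rd d) 1, ‖inner ℝ (w : Rd d) e‖ₑ ^ p
        ∂(volume : Measure (Rd d)).toSphere := by
  obtain ⟨R, hR0, hRt, hR⟩ := radial_ball_integral he p hp.le
  -- Multiplying by `R` turns both spherical integrals into integrals over the ball, where linear
  -- isometries preserve Lebesgue measure.
  refine (ENNReal.mul_left_inj hR0 hRt).1 ?_
  rw [mul_assoc, ← hR, ← hR]
  rcases eq_or_ne a 0 with rfl | ha
  · simp [hp]
  have hn : ‖a‖ ≠ 0 := norm_ne_zero_iff.2 ha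
  set b : Rd d := ‖a‖⁻¹ • a
  have hb : ‖e‖ = ‖b‖ := by
    rw [he, norm_smul, norm_inv, norm_norm, inv_mul_cancel₀ hn]
  have hab : a = ‖a‖ • b := by
    rw [smul_smul, mul_inv_cancel₀ hn, one_smul]
  -- The reflection in the hyperplane orthogonal to $e-b$ exchanges the unit vectors $e$ and $b$.
  set Q : Rd d ≃ₗᵢ[ℝ] Rd d := Submodule.reflection (Submodule.span ℝ {e - b})ᗮ
  have hQ : Q e = b := Submodule.reflection_sub hb
  rw [← lintegral_const_mul _ (by fun_prop)]
  have mp : MeasurePreserving Q (volume.restrict (Metric.ball (0 : Rd d) 1))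
      (volume.restrict (Metric.ball (0 : Rd d) 1)) := by
    have := Q.measurePreserving.restrict_preimage
      (measurableSet_ball : MeasurableSet (Metric.ball (0 : Rd d) 1))
    rwa [Q.preimage_ball, map_zero] at this
  rw [← mp.lintegral_comp_emb Q.toHomeomorph.measurableEmbedding]
  refine lintegral_congr fun h => ?_
  conv_lhs => rw [hab, ← hQ]
  rw [real_inner_smul_right, Q.inner_map_map, enorm_mul, ENNReal.mul_rpow_of_nonneg _ _ hp.le,
    enorm_norm]

theorem sphereMean_mul {e : Rd d} (he : ‖e‖ = 1) (p : ℝ) :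
    (∫⁻ w : Metric.sphere (0 : Rd d) 1, ‖inner ℝ (w : Rd d) e‖ₑ ^ p
        ∂(volume : Measure (Rd d)).toSphere) =
      sphereMean e p * (volume : Measure (Rd d)).toSphere univ := by
  have := nontrivial_Rd he
  rw [sphereMean, laverage_eq, ENNReal.div_mul_cancel
    (Measure.measure_univ_ne_zero.2 (Measure.toSphere_ne_zero _)) (measure_ne_top _ _)]

/-- Vanishing would force $h\cdot e=0$ a.e. on the unit ball, but $e^\perp$ is a null set. This
makes the claims trivial when the right-hand seminorm is infinite, since then the product is
$\infty$. -/
theorem sphereMean_ne_zero {e : Rd d} (he : ‖e‖ = 1) {p : ℝ} (hp : 0 < p) :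
    sphereMean e p ≠ 0 := by
  intro h0
  obtain ⟨R, -, -, hR⟩ := radial_ball_integral he p hp.le
  have h1 := hR e
  rw [sphereMean_mul he, h0, zero_mul, zero_mul, lintegral_eq_zero_iff (by fun_prop)] at h1
  have h2 : volume ((LinearMap.ker (innerₛₗ ℝ e) : Submodule ℝ (Rd d)) : Set (Rd d)) = 0 := by
    refine Measure.addHaar_submodule _ _ fun ht => ?_
    have : e ∈ LinearMap.ker (innerₛₗ ℝ e) := ht ▸ Submodule.mem_top
    simp [he] at this
  have h3 : ∀ᵐ h : Rd d ∂volume.restrict (Metric.ball 0 1), inner ℝ h e = 0 := by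
    filter_upwards [h1] with h hh
    have := (ENNReal.rpow_eq_zero_iff.1 hh)
    simpa using this.resolve_right (by simp)|>.1
  rw [ae_iff, Measure.restrict_apply' measurableSet_ball] at h3
  have h4 : volume (Metric.ball (0 : Rd d) 1) = 0 := by
    refine measure_mono_null (t := {a : Rd d | ¬ inner ℝ a e = 0} ∩ Metric.ball 0 1 ∪
      ((LinearMap.ker (innerₛₗ ℝ e) : Submodule ℝ (Rd d)) : Set (Rd d))) (fun x hx => ?_)
      (measure_union_null h3 h2)
    by_cases h : inner ℝ x e = 0
    · right
      simpa [real_inner_comm] using h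
    · exact Or.inl ⟨h, hx⟩
  exact (Metric.measure_ball_pos volume (0 : Rd d) one_pos).ne' h4

/-- Averaging `|h · a|^p` against a radial density. -/
theorem lintegral_radial_mul_inner {e : Rd d} (he : ‖e‖ = 1) {f : Rd d → ℝ≥0∞}
    (hf : AEMeasurable f volume) (hrad : ∀ h k : Rd d, h ≠ 0 → ‖h‖ = ‖k‖ → f h = f k)
    {p : ℝ} (hp : 0 < p) (a : Rd d) :
    ∫⁻ h, f h * ‖inner ℝ h a‖ₑ ^ p = sphereMean e p * ‖a‖ₑ ^ p * ∫⁻ h, f h * ‖h‖ₑ ^ p := by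
  rw [lintegral_radial_mul_homogeneous he hf hrad p (Φ := fun h => ‖inner ℝ h a‖ₑ ^ p)
      (by fun_prop) fun r w hr => enorm_inner_smul_rpow a p hp.le r w hr,
    lintegral_radial_mul_homogeneous he hf hrad p (Φ := fun h => ‖h‖ₑ ^ p) (by fun_prop)
      fun r w hr => by
        rw [enorm_smul, ENNReal.mul_rpow_of_nonneg _ _ hp.le, Real.enorm_eq_ofReal hr.le],
    lintegral_sphere_inner he p hp, sphereMean_mul he]
  have hs : (∫⁻ w : Metric.sphere (0 : Rd d) 1, ‖(w : Rd d)‖ₑ ^ p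
      ∂(volume : Measure (Rd d)).toSphere) = (volume : Measure (Rd d)).toSphere univ := by
    rw [← lintegral_one]
    refine lintegral_congr fun w => ?_
    have : ‖w.1‖ₑ = 1 := by rw [← ofReal_norm]; simp
    simp [this]
  rw [hs]
  ring

end Polar

/-! ### Reduction to translation estimates -/

section Reduction

variable {d : ℕ} {p : ℝ} {Ω : Set (Rd d)}

theorem nonlocalEnergy_congr (ν : Rd d → ℝ≥0∞) {u v : Rd d → ℝ}
    (h : u =ᵐ[volume.restrict Ω] v) : nonlocalEnergy p ν Ω u = nonlocalEnergy p ν Ω v := by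
  refine lintegral_congr_ae ?_
  filter_upwards [h] with x hx
  refine lintegral_congr_ae ?_
  filter_upwards [h] with y hy
  rw [hx, hy]

/-- `∫_Ω |v(x+h) - v(x)|^p dx`. -/
def translationEnergy (p : ℝ) (Ω : Set (Rd d)) (v : Rd d → ℝ) (h : Rd d) : ℝ≥0∞ :=
  ∫⁻ x in Ω, ‖v (x + h) - v x‖ₑ ^ p

/-- Only the inner variable is released from $\Omega$ to $\mathbb{R}^d$; the substitution $y=x+h$,
the symmetry of the kernel and Tonelli do the rest. -/
theorem nonlocalEnergy_le_lintegral_translationEnergy {ν : Rd d → ℝ≥0∞} (hν : AEMeasurable ν)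
    (hsymm : ∀ h, ν (-h) = ν h) {v : Rd d → ℝ} (hv : Measurable v) :
    nonlocalEnergy p ν Ω v ≤ ∫⁻ h, ν h * translationEnergy p Ω v h := by
  calc nonlocalEnergy p ν Ω v
      ≤ ∫⁻ x in Ω, ∫⁻ y, ‖v x - v y‖ₑ ^ p * ν (x - y) :=
        lintegral_mono fun x => setLIntegral_le_lintegral _ _
    _ = ∫⁻ x in Ω, ∫⁻ h, ν h * ‖v (x + h) - v x‖ₑ ^ p := by
        refine lintegral_congr fun x => ?_
        rw [← lintegral_add_left_eq_self _ x]
        refine lintegral_congr fun h => ?_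
        rw [sub_add_cancel_left, hsymm, mul_comm, ← enorm_neg, neg_sub]
    _ = ∫⁻ h, ∫⁻ x in Ω, ν h * ‖v (x + h) - v x‖ₑ ^ p := by
        refine lintegral_lintegral_swap ?_
        exact (AEMeasurable.comp_snd hν).mul (Measurable.aemeasurable (by fun_prop))
    _ = ∫⁻ h, ν h * translationEnergy p Ω v h := by
        refine lintegral_congr fun h => ?_
        rw [translationEnergy, lintegral_const_mul _ (by fun_prop)]

/-- A crude bound uniform in $h$, used for the large translations. -/
theorem translationEnergy_le (hp : 1 ≤ p) {v : Rd d → ℝ} (hv : Measurable v) (h : Rd d) :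
    translationEnergy p Ω v h ≤ 2 ^ (p - 1) * (2 * ∫⁻ x, ‖v x‖ₑ ^ p) := by
  calc translationEnergy p Ω v h ≤ ∫⁻ x, ‖v (x + h) - v x‖ₑ ^ p := setLIntegral_le_lintegral _ _
    _ ≤ ∫⁻ x, 2 ^ (p - 1) * (‖v (x + h)‖ₑ ^ p + ‖v x‖ₑ ^ p) := by
        refine lintegral_mono fun x => ?_
        refine le_trans ?_ (ENNReal.rpow_add_le_mul_rpow_add_rpow _ _ hp)
        gcongr
        exact enorm_sub_le
    _ = 2 ^ (p - 1) * (2 * ∫⁻ x, ‖v x‖ₑ ^ p) := by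
        rw [lintegral_const_mul _ (by fun_prop), lintegral_add_left (by fun_prop),
          lintegral_add_right_eq_self (fun x => ‖v x‖ₑ ^ p) h, two_mul]

theorem IsPLevyApprox.neg_eq {ν : ℝ → Rd d → ℝ≥0∞} (hν : IsPLevyApprox p ν) {ε : ℝ} (hε : 0 < ε)
    (h : Rd d) : ν ε (-h) = ν ε h := by
  rcases eq_or_ne h 0 with rfl | h0
  · simp
  · exact (hν.radial ε hε h (-h) h0 (norm_neg h).symm).symm

/-- Only small translations contribute to the limit of the nonlocal energies. -/
theorem limsup_nonlocalEnergy_le (hp : 1 ≤ p) {ν : ℝ → Rd d → ℝ≥0∞} (hν : IsPLevyApprox p ν)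
    {v : Rd d → ℝ} (hv : Measurable v) (hvp : ∫⁻ x, ‖v x‖ₑ ^ p ≠ ⊤) {δ : ℝ} (hδ : 0 < δ)
    {B : ℝ≥0∞} (hB : ∀ ε, 0 < ε →
      ∫⁻ h in {h : Rd d | ‖h‖ ≤ δ}, ν ε h * translationEnergy p Ω v h ≤ B) :
    limsup (fun ε : ℝ => nonlocalEnergy p (ν ε) Ω v) (𝓝[>] 0) ≤ B := by
  set M : ℝ≥0∞ := 2 ^ (p - 1) * (2 * ∫⁻ x, ‖v x‖ₑ ^ p)
  have hM : M ≠ ⊤ := by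
    refine ENNReal.mul_ne_top (ENNReal.rpow_ne_top_of_nonneg (by linarith) (by simp)) ?_
    exact ENNReal.mul_ne_top (by simp) hvp
  -- A lower bound for $1\wedge|h|^p$ on $|h|>\delta$, so that $\nu_\varepsilon\le
  -- c^{-1}(1\wedge|h|^p)\nu_\varepsilon$ there.
  set c : ℝ≥0∞ := min 1 (ENNReal.ofReal δ ^ p)
  have hc0 : c ≠ 0 := by
    have : 0 < ENNReal.ofReal δ ^ p :=
      ENNReal.rpow_pos (ENNReal.ofReal_pos.2 hδ) ENNReal.ofReal_ne_top
    exact (lt_min one_pos this).ne'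
  have hct : c ≠ ⊤ := ((min_le_left _ _).trans_lt ENNReal.one_lt_top).ne
  have hms : MeasurableSet {h : Rd d | δ < ‖h‖} := measurableSet_lt measurable_const measurable_norm
  have hle : ∀ ε : ℝ, 0 < ε → nonlocalEnergy p (ν ε) Ω v ≤
      B + M * (c⁻¹ * ∫⁻ h in {h : Rd d | δ < ‖h‖}, min 1 (‖h‖ₑ ^ p) * ν ε h) := by
    intro ε hε
    refine (nonlocalEnergy_le_lintegral_translationEnergy (hν.measurable ε hε) (hν.neg_eq hε)
      hv).trans ?_
    rw [← lintegral_add_compl _ hms.compl, compl_compl]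
    refine add_le_add (le_of_eq_of_le ?_ (hB ε hε)) ?_
    · congr 2
      ext h
      simp
    · rw [← lintegral_const_mul' _ _ (ENNReal.inv_ne_top.2 hc0), ← lintegral_const_mul' _ _ hM]
      refine setLIntegral_mono' hms fun h hh => ?_
      rw [mul_comm]
      refine mul_le_mul' (translationEnergy_le hp hv h) ?_
      rw [← mul_assoc]
      refine le_mul_of_one_le_left zero_le ?_
      have h1 : c ≤ min 1 (‖h‖ₑ ^ p) := by
        refine le_min (min_le_left _ _) ((min_le_right _ _).trans ?_)
        rw [← ofReal_norm]
        gcongr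
        exact le_of_lt hh
      exact (ENNReal.inv_mul_cancel hc0 hct).ge.trans (by gcongr)
  have hlim : Tendsto (fun ε : ℝ =>
      B + M * (c⁻¹ * ∫⁻ h in {h : Rd d | δ < ‖h‖}, min 1 (‖h‖ₑ ^ p) * ν ε h)) (𝓝[>] 0)
      (𝓝 (B + M * (c⁻¹ * 0))) :=
    tendsto_const_nhds.add (ENNReal.Tendsto.const_mul (ENNReal.Tendsto.const_mul
      (hν.concentration δ hδ) (Or.inr (ENNReal.inv_ne_top.2 hc0))) (Or.inr hM))
  rw [mul_zero, mul_zero, add_zero] at hlim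
  rw [← hlim.limsup_eq]
  refine limsup_le_limsup ?_
  filter_upwards [self_mem_nhdsWithin] with ε hε
  exact hle ε hε

/-- For $|h|\le1$ the weight $1\wedge|h|^p$ is $|h|^p$, and the total weighted mass is 1. -/
theorem IsPLevyApprox.lintegral_norm_le_one {ν : ℝ → Rd d → ℝ≥0∞} (hν : IsPLevyApprox p ν)
    (hp : 0 ≤ p) {ε δ : ℝ} (hε : 0 < ε) (hδ : δ ≤ 1) :
    ∫⁻ h in {h : Rd d | ‖h‖ ≤ δ}, ν ε h * ‖h‖ₑ ^ p ≤ 1 := by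
  rw [← hν.integral_eq_one ε hε]
  refine le_trans (setLIntegral_mono' (measurableSet_le measurable_norm measurable_const)
    fun h hh => ?_) (setLIntegral_le_lintegral _ _)
  rw [mul_comm, min_eq_right]
  refine ENNReal.rpow_le_one ?_ hp
  rw [← ofReal_norm, ENNReal.ofReal_le_one]
  exact le_trans hh hδ

/-- The radial kernels average directional derivatives into the norm of the gradient. -/
theorem IsPLevyApprox.lintegral_inner_le {ν : ℝ → Rd d → ℝ≥0∞} (hν : IsPLevyApprox p ν)
    (hp : 0 < p) {e : Rd d} (he : ‖e‖ = 1) {ε δ : ℝ} (hε : 0 < ε) (hδ : δ ≤ 1)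
    {g : Rd d → Rd d} (hg : AEMeasurable g (volume.restrict Ω)) :
    ∫⁻ h in {h : Rd d | ‖h‖ ≤ δ}, ν ε h * ∫⁻ x in Ω, ‖inner ℝ h (g x)‖ₑ ^ p ≤
      sphereMean e p * ∫⁻ x in Ω, ‖g x‖ₑ ^ p := by
  have hms : MeasurableSet {h : Rd d | ‖h‖ ≤ δ} := measurableSet_le measurable_norm measurable_const
  -- The truncated kernel is still radial, so the averaging formula applies to it pointwise in $x$
  -- after Tonelli.
  set f : Rd d → ℝ≥0∞ := {h : Rd d | ‖h‖ ≤ δ}.indicator (ν ε)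
  have hf : AEMeasurable f := (hν.measurable ε hε).indicator hms
  have hrad : ∀ h k : Rd d, h ≠ 0 → ‖h‖ = ‖k‖ → f h = f k := by
    intro h k h0 hk
    simp [f, indicator, hk, hν.radial ε hε h k h0 hk]
  have hset : ∀ Φ : Rd d → ℝ≥0∞,
      ∫⁻ h in {h : Rd d | ‖h‖ ≤ δ}, ν ε h * Φ h = ∫⁻ h, f h * Φ h := by
    intro Φ
    rw [← lintegral_indicator hms]
    refine lintegral_congr fun h => ?_
    by_cases hh : ‖h‖ ≤ δ <;> simp [f, hh]
  have hmass : ∫⁻ h, f h * ‖h‖ₑ ^ p ≤ 1 := by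
    rw [← hset]
    exact hν.lintegral_norm_le_one hp.le hε hδ
  have hgsnd : AEMeasurable (fun z : Rd d × Rd d => ‖inner ℝ z.1 (g z.2)‖ₑ ^ p)
      (volume.prod (volume.restrict Ω)) := by
    have h1 : AEMeasurable (fun z : Rd d × Rd d => g z.2) (volume.prod (volume.restrict Ω)) :=
      AEMeasurable.comp_snd hg
    exact ((measurable_fst.aemeasurable.inner h1).enorm).pow_const p
  calc ∫⁻ h in {h : Rd d | ‖h‖ ≤ δ}, ν ε h * ∫⁻ x in Ω, ‖inner ℝ h (g x)‖ₑ ^ p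
      = ∫⁻ h, ∫⁻ x in Ω, f h * ‖inner ℝ h (g x)‖ₑ ^ p := by
        rw [hset]
        refine lintegral_congr fun h => ?_
        rw [lintegral_const_mul'']
        exact ((aemeasurable_const.inner hg).enorm).pow_const p
    _ = ∫⁻ x in Ω, ∫⁻ h, f h * ‖inner ℝ h (g x)‖ₑ ^ p :=
        lintegral_lintegral_swap ((AEMeasurable.comp_fst hf).mul hgsnd)
    _ ≤ ∫⁻ x in Ω, sphereMean e p * ‖g x‖ₑ ^ p := by
        refine lintegral_mono fun x => ?_
        rw [lintegral_radial_mul_inner he hf hrad hp]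
        exact mul_le_of_le_one_right zero_le hmass
    _ = _ := by
        rw [lintegral_const_mul'']
        exact (hg.enorm).pow_const p

end Reduction

/-! ### Differences of weakly differentiable functions -/

section WeakGradient

variable {d : ℕ} {Ω : Set (Rd d)}

theorem IsWeakGrad.congr_grad {u : Rd d → ℝ} {g k : Rd d → Rd d} (h : IsWeakGrad Ω u g)
    (hgk : g =ᵐ[volume.restrict Ω] k) : IsWeakGrad Ω u k where
  locInt := h.locInt
  locInt_grad := h.locInt_grad.congr hgk
  integral_eq φ h1 h2 h3 i := by
    rw [h.integral_eq φ h1 h2 h3 i]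
    congr 1
    refine integral_congr_ae ?_
    filter_upwards [hgk] with x hx
    rw [hx]

theorem setIntegral_eq_of_tsupport_subset {f : Rd d → ℝ} {U : Set (Rd d)} (h : tsupport f ⊆ U) :
    ∫ x in U, f x = ∫ x, f x :=
  setIntegral_eq_integral_of_forall_compl_eq_zero fun _ hx =>
    image_eq_zero_of_notMem_tsupport fun h' => hx (h h')

theorem IsWeakGrad.mono {U : Set (Rd d)} {u : Rd d → ℝ} {g : Rd d → Rd d}
    (h : IsWeakGrad Ω u g) (hU : U ⊆ Ω) : IsWeakGrad U u g where
  locInt := h.locInt.mono_set hU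
  locInt_grad := h.locInt_grad.mono_set hU
  integral_eq φ h1 h2 h3 i := by
    have e1 : tsupport (fun x => u x * fderiv ℝ φ x (stdVec i)) ⊆ U :=
      (tsupport_mul_subset_right.trans (tsupport_fderiv_apply_subset ℝ _)).trans h3
    have e2 : tsupport (fun x => g x i * φ x) ⊆ U := tsupport_mul_subset_right.trans h3
    have := h.integral_eq φ h1 h2 (h3.trans hU) i
    rwa [setIntegral_eq_of_tsupport_subset (e1.trans hU),
      setIntegral_eq_of_tsupport_subset (e2.trans hU), ← setIntegral_eq_of_tsupport_subset e1,
      ← setIntegral_eq_of_tsupport_subset e2] at this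

/-- Weak gradients are unique. -/
theorem IsWeakGrad.ae_eq (hΩ : IsOpen Ω) {u : Rd d → ℝ} {g k : Rd d → Rd d}
    (hg : IsWeakGrad Ω u g) (hk : IsWeakGrad Ω u k) : g =ᵐ[volume.restrict Ω] k := by
  have hcoord : ∀ i : Fin d, ∀ᵐ x, x ∈ Ω → g x i - k x i = 0 := by
    intro i
    refine hΩ.ae_eq_zero_of_integral_contDiff_smul_eq_zero
      ((locInt_coord hg.locInt_grad i).sub (locInt_coord hk.locInt_grad i)) fun φ h1 h2 h3 => ?_
    have e : tsupport (fun x => φ x • (g x i - k x i)) ⊆ Ω := tsupport_mul_subset_left.trans h3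
    rw [← setIntegral_eq_of_tsupport_subset e]
    simp only [smul_eq_mul, mul_comm (φ _), sub_mul]
    rw [integral_sub (integrable_mul_of_locInt (locInt_coord hg.locInt_grad i) h1.continuous h2 h3)
      (integrable_mul_of_locInt (locInt_coord hk.locInt_grad i) h1.continuous h2 h3)]
    have := (hg.integral_eq φ h1 h2 h3 i).symm.trans (hk.integral_eq φ h1 h2 h3 i)
    linarith
  filter_upwards [ae_restrict_of_ae (ae_all_iff.2 hcoord), ae_restrict_mem hΩ.measurableSet]
    with x hx hxΩ
  ext i
  exact sub_eq_zero.1 (hx i hxΩ)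

theorem IsWeakGrad.integral_inner_eq {u : Rd d → ℝ} {g : Rd d → Rd d} (h : IsWeakGrad Ω u g)
    {φ : Rd d → ℝ} (h1 : ContDiff ℝ ∞ φ) (h2 : HasCompactSupport φ) (h3 : tsupport φ ⊆ Ω)
    (v : Rd d) : ∫ x in Ω, u x * fderiv ℝ φ x v = - ∫ x in Ω, inner ℝ v (g x) * φ x := by
  have hv : ∀ x, fderiv ℝ φ x v = ∑ i, v i * fderiv ℝ φ x (stdVec i) := by
    intro x
    conv_lhs => rw [← (EuclideanSpace.basisFun (Fin d) ℝ).sum_repr v]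
    simp [map_sum]
  have hi : ∀ x, inner ℝ v (g x) = ∑ i, v i * g x i := by
    intro x
    simp [PiLp.inner_apply, mul_comm]
  simp only [hv, hi, Finset.mul_sum, Finset.sum_mul]
  rw [integral_finsetSum, integral_finsetSum, ← Finset.sum_neg_distrib]
  · refine Finset.sum_congr rfl fun i _ => ?_
    have := h.integral_eq φ h1 h2 h3 i
    simp only [mul_left_comm _ (v i), mul_assoc (v i), integral_const_mul]
    rw [this]
    ring
  · intro i _
    simpa only [mul_assoc] using (integrable_mul_of_locInt (locInt_coord h.locInt_grad i)
      h1.continuous h2 h3).const_mul (v i)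
  · intro i _
    simpa only [mul_left_comm _ (v i)] using
      (integrable_mul_partial h.locInt h1 h2 h3 (stdVec i)).const_mul (v i)

/-! ### Integrals along the segments from $x$ to $x+h$. -/

theorem exists_subset_closedBall {φ : Rd d → ℝ} (hc : HasCompactSupport φ) :
    ∃ R, ∀ x, φ x ≠ 0 → ‖x‖ ≤ R := by
  obtain ⟨R, hR⟩ := hc.isBounded.subset_closedBall (0 : Rd d)
  exact ⟨R, fun x hx => by simpa using hR (subset_tsupport _ hx)⟩

instance isProbabilityMeasure_restrict_Ioc_zero_one :
    IsProbabilityMeasure ((volume : Measure ℝ).restrict (Ioc 0 1)) := ⟨by simp⟩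

/-- Each slice at fixed $t$ is a translate of `g` with the same $L^1$ norm, and $t$ ranges over a
probability space. -/
theorem integrable_comp_add_smul {E : Type*} [NormedAddCommGroup E] {g : Rd d → E}
    (hgm : StronglyMeasurable g) (hg : Integrable g) (h : Rd d) :
    Integrable (fun z : Rd d × ℝ => g (z.1 + z.2 • h))
      (volume.prod (volume.restrict (Ioc 0 1))) := by
  have hm : StronglyMeasurable (fun z : Rd d × ℝ => g (z.1 + z.2 • h)) :=
    hgm.comp_measurable (by fun_prop)
  rw [integrable_prod_iff' hm.aestronglyMeasurable]
  refine ⟨Eventually.of_forall fun t => hg.comp_add_right (t • h), ?_⟩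
  simp only [integral_add_right_eq_self (fun x => ‖g x‖)]
  exact integrable_const _

theorem ball_add_smul_mem {R : ℝ} {x h : Rd d} (hx : ‖x‖ ≤ R) {t : ℝ} (ht : t ∈ Ioc (0 : ℝ) 1) :
    x + t • h ∈ Metric.closedBall (0 : Rd d) (R + ‖h‖) := by
  rw [mem_closedBall_zero_iff]
  refine (norm_add_le _ _).trans (add_le_add hx ?_)
  rw [norm_smul, Real.norm_eq_abs, abs_of_pos ht.1]
  exact mul_le_of_le_one_left (norm_nonneg _) ht.2

/-- Segments starting in the ball of radius $n$ stay in the ball of radius $n+|h|$, so there `g` may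
be replaced by an integrable truncation; countably many $n$ cover the space. -/
theorem ae_integrable_comp_add_smul {g : Rd d → Rd d} (hgm : StronglyMeasurable g)
    (hg : LocallyIntegrable g) (h : Rd d) :
    ∀ᵐ x : Rd d, Integrable (fun t : ℝ => g (x + t • h)) (volume.restrict (Ioc 0 1)) := by
  have key : ∀ n : ℕ, ∀ᵐ x : Rd d, ‖x‖ ≤ n →
      Integrable (fun t : ℝ => g (x + t • h)) (volume.restrict (Ioc 0 1)) := by
    intro n
    set K := Metric.closedBall (0 : Rd d) (n + ‖h‖)
    have hK : Integrable (K.indicator g) :=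
      (hg.integrableOn_isCompact (isCompact_closedBall _ _)).integrable_indicator
        measurableSet_closedBall
    filter_upwards [(integrable_comp_add_smul (hgm.indicator measurableSet_closedBall)
      hK h).prod_right_ae] with x hx hxn
    refine hx.congr ?_
    filter_upwards [ae_restrict_mem measurableSet_Ioc] with t ht
    exact indicator_of_mem (ball_add_smul_mem hxn ht) _
  filter_upwards [ae_all_iff.2 key] with x hx
  obtain ⟨n, hn⟩ := exists_nat_ge ‖x‖
  exact hx n hn

theorem locallyIntegrable_integral_comp_add_smul {g : Rd d → Rd d} (hgm : StronglyMeasurable g)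
    (hg : LocallyIntegrable g) (h : Rd d) :
    LocallyIntegrable (fun x : Rd d => ∫ t in Ioc (0 : ℝ) 1, inner ℝ h (g (x + t • h))) := by
  rw [locallyIntegrable_iff]
  intro K' hK'
  obtain ⟨R, hR⟩ := hK'.isBounded.subset_closedBall (0 : Rd d)
  refine IntegrableOn.mono_set ?_ hR
  set K := Metric.closedBall (0 : Rd d) (R + ‖h‖)
  have hK : Integrable (K.indicator g) :=
    (hg.integrableOn_isCompact (isCompact_closedBall _ _)).integrable_indicator
      measurableSet_closedBall
  have h1 := ((integrable_comp_add_smul (hgm.indicator measurableSet_closedBall)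
      hK h).const_inner (𝕜 := ℝ) h).integral_prod_left
  refine (h1.integrableOn (s := Metric.closedBall 0 R)).congr_fun (fun x hx => ?_)
    measurableSet_closedBall
  refine setIntegral_congr_fun measurableSet_Ioc fun t ht => ?_
  simp only
  rw [indicator_of_mem (ball_add_smul_mem (mem_closedBall_zero_iff.1 hx) ht)]

/-- The fundamental theorem of calculus along almost every segment in a given direction. -/
theorem IsWeakGrad.ae_sub_eq_integral {v : Rd d → ℝ} {g : Rd d → Rd d}
    (hv : IsWeakGrad univ v g) (hgm : StronglyMeasurable g) (h : Rd d) :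
    ∀ᵐ x : Rd d, v (x + h) - v x = ∫ t in Ioc (0 : ℝ) 1, inner ℝ h (g (x + t • h)) := by
  have hvl : LocallyIntegrable v := locallyIntegrableOn_univ.1 hv.locInt
  have hgl : LocallyIntegrable g := locallyIntegrableOn_univ.1 hv.locInt_grad
  have hvh : LocallyIntegrable (fun x => v (x + h)) := by
    rw [locallyIntegrable_iff]
    intro K hK
    have h1 := hvl.integrableOn_isCompact (hK.image (continuous_add_const h))
    have h2 := (measurePreserving_add_right (volume : Measure (Rd d)) h).integrableOn_image
      (measurableEmbedding_addRight h) (f := v) (s := K)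
    exact h2.1 h1
  -- Both sides are tested against smooth $\varphi$: move the translation onto $\varphi$, apply the
  -- fundamental theorem of calculus to $\varphi$ along the segment, exchange integrals, integrate
  -- by parts weakly and translate back.
  refine ae_eq_of_integral_contDiff_smul_eq (hvh.sub hvl)
    (locallyIntegrable_integral_comp_add_smul hgm hgl h) fun φ h1 h2 => ?_
  obtain ⟨R, hR⟩ := exists_subset_closedBall h2
  obtain ⟨C, hC⟩ := h2.exists_bound_of_continuous h1.continuous
  have h2' : HasCompactSupport (fun x => fderiv ℝ φ x h) := h2.fderiv_apply (𝕜 := ℝ) h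
  have hdc : Continuous (fun x => fderiv ℝ φ x h) := continuous_partial h1 h
  obtain ⟨R', hR'⟩ := exists_subset_closedBall h2'
  obtain ⟨C', hC'⟩ := h2'.exists_bound_of_continuous hdc
  have hshift : ∀ k : Rd d, ContDiff ℝ ∞ (fun x => φ (x - k)) ∧
      HasCompactSupport (fun x => φ (x - k)) := fun k =>
    ⟨h1.comp (contDiff_id.sub contDiff_const), h2.comp_homeomorph (Homeomorph.subRight k)⟩
  have hder : ∀ k x : Rd d, fderiv ℝ (fun x => φ (x - k)) x = fderiv ℝ φ (x - k) := fun k x =>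
    fderiv_comp_sub k
  -- As `v` is only locally integrable, it is cut off to a ball outside which the factor with
  -- $\varphi$ vanishes for all $t\in(0,1]$.
  have hI1 : Integrable (fun z : Rd d × ℝ => v z.1 * fderiv ℝ φ (z.1 - z.2 • h) h)
      (volume.prod (volume.restrict (Ioc 0 1))) := by
    set K := Metric.closedBall (0 : Rd d) (R' + ‖h‖)
    have hK : Integrable (K.indicator v) :=
      (hvl.integrableOn_isCompact (isCompact_closedBall _ _)).integrable_indicator
        measurableSet_closedBall
    have h3 : Integrable (fun z : Rd d × ℝ => K.indicator v z.1 * fderiv ℝ φ (z.1 - z.2 • h) h)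
        (volume.prod (volume.restrict (Ioc 0 1))) := by
      refine (hK.comp_fst _).mul_bdd (c := C') ?_ (Eventually.of_forall fun z => hC' _)
      exact (hdc.comp (by fun_prop)).aestronglyMeasurable
    refine h3.congr ?_
    have hmem : ∀ᵐ z : Rd d × ℝ ∂(volume.prod (volume.restrict (Ioc 0 1))), z.2 ∈ Ioc (0 : ℝ) 1 :=
      Measure.quasiMeasurePreserving_snd.ae (ae_restrict_mem measurableSet_Ioc)
    filter_upwards [hmem] with z hz
    by_cases h0 : fderiv ℝ φ (z.1 - z.2 • h) h = 0
    · simp [h0]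
    · rw [indicator_of_mem]
      have := ball_add_smul_mem (h := h) (hR' _ h0) hz
      rwa [sub_add_cancel] at this
  have hI2 : Integrable (fun z : Rd d × ℝ => φ z.1 * inner ℝ h (g (z.1 + z.2 • h)))
      (volume.prod (volume.restrict (Ioc 0 1))) := by
    set K := Metric.closedBall (0 : Rd d) (R + ‖h‖)
    have hK : Integrable (K.indicator g) :=
      (hgl.integrableOn_isCompact (isCompact_closedBall _ _)).integrable_indicator
        measurableSet_closedBall
    have h3 := ((integrable_comp_add_smul (hgm.indicator measurableSet_closedBall)
      hK h).const_inner (𝕜 := ℝ) h).bdd_mul (f := fun z : Rd d × ℝ => φ z.1) (c := C)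
      (h1.continuous.comp continuous_fst).aestronglyMeasurable (Eventually.of_forall fun z => hC _)
    refine h3.congr ?_
    have hmem : ∀ᵐ z : Rd d × ℝ ∂(volume.prod (volume.restrict (Ioc 0 1))), z.2 ∈ Ioc (0 : ℝ) 1 :=
      Measure.quasiMeasurePreserving_snd.ae (ae_restrict_mem measurableSet_Ioc)
    filter_upwards [hmem] with z hz
    by_cases h0 : φ z.1 = 0
    · simp [h0]
    · rw [indicator_of_mem]
      exact ball_add_smul_mem (h := h) (hR _ h0) hz
  have hint : ∀ k : Rd d, Integrable (fun x => v x * φ (x - k)) := fun k => by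
    have := integrable_mul_of_locInt hv.locInt (hshift k).1.continuous (hshift k).2 (subset_univ _)
    rwa [Measure.restrict_univ] at this
  calc ∫ x, φ x • (v (x + h) - v x)
      = ∫ x, v x * (φ (x - h) - φ x) := by
        have e1 : ∫ x, φ x * v (x + h) = ∫ x, v x * φ (x - h) := by
          rw [← integral_add_right_eq_self (fun x => v x * φ (x - h)) h]
          simp [mul_comm]
        have i1 : Integrable (fun x => φ x * v (x + h)) := by
          simpa [mul_comm] using (hint h).comp_add_right h
        have i0 : Integrable (fun x => v x * φ x) := by simpa using hint 0
        simp only [smul_eq_mul, mul_sub]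
        rw [integral_sub i1 (by simpa [mul_comm] using i0), integral_sub (hint h) i0, e1]
        simp [mul_comm]
    _ = ∫ x, ∫ t in Ioc (0 : ℝ) 1, - (v x * fderiv ℝ φ (x - t • h) h) := by
        refine integral_congr_ae (Eventually.of_forall fun x => ?_)
        simp only
        rw [integral_neg, integral_const_mul, ← intervalIntegral.integral_of_le zero_le_one]
        have hd : ∀ t ∈ uIcc (0 : ℝ) 1,
            HasDerivAt (fun t : ℝ => φ (x - t • h)) (- fderiv ℝ φ (x - t • h) h) t := by
          intro t _
          have e1 : HasDerivAt (fun t : ℝ => x - t • h) (-h) t := by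
            simpa using ((hasDerivAt_id t).smul_const h).const_sub x
          have e2 := ((h1.differentiable (by simp)) (x - t • h)).hasFDerivAt.comp_hasDerivAt t e1
          rw [map_neg] at e2
          exact e2
        have hc : IntervalIntegrable (fun t : ℝ => - fderiv ℝ φ (x - t • h) h) volume 0 1 :=
          (hdc.comp (by fun_prop : Continuous fun t : ℝ => x - t • h)).neg.intervalIntegrable _ _
        have := intervalIntegral.integral_eq_sub_of_hasDerivAt hd hc
        rw [intervalIntegral.integral_neg] at this
        simp only [one_smul, zero_smul, sub_zero] at this
        rw [← this]
        ring
    _ = ∫ t in Ioc (0 : ℝ) 1, ∫ x, - (v x * fderiv ℝ φ (x - t • h) h) :=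
        integral_integral_swap hI1.neg
    _ = ∫ t in Ioc (0 : ℝ) 1, ∫ x, φ x * inner ℝ h (g (x + t • h)) := by
        refine integral_congr_ae (Eventually.of_forall fun t => ?_)
        simp only
        have := hv.integral_inner_eq (hshift (t • h)).1 (hshift (t • h)).2 (subset_univ _) h
        simp only [Measure.restrict_univ, hder] at this
        rw [integral_neg, this, neg_neg,
          ← integral_add_right_eq_self (fun x => inner ℝ h (g x) * φ (x - t • h)) (t • h)]
        simp [mul_comm]
    _ = ∫ x, ∫ t in Ioc (0 : ℝ) 1, φ x * inner ℝ h (g (x + t • h)) :=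
        (integral_integral_swap hI2).symm
    _ = ∫ x, φ x • ∫ t in Ioc (0 : ℝ) 1, inner ℝ h (g (x + t • h)) := by
        simp only [integral_const_mul, smul_eq_mul]

end WeakGradient

/-! ### The Sobolev case -/

section Sobolev

variable {d : ℕ} {p : ℝ} {Ω : Set (Rd d)}

/-- Jensen's inequality for powers of the norm of an integral. -/
theorem enorm_integral_rpow_le {α E : Type*} [MeasurableSpace α] [NormedAddCommGroup E]
    [NormedSpace ℝ E] {μ : Measure α} [IsProbabilityMeasure μ] (hp : 1 ≤ p) (f : α → E) :
    ‖∫ x, f x ∂μ‖ₑ ^ p ≤ ∫⁻ x, ‖f x‖ₑ ^ p ∂μ := by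
  have hp0 : 0 < p := by linarith
  by_cases hf : AEStronglyMeasurable f μ
  · have h1 := eLpNorm'_le_eLpNorm'_of_exponent_le one_pos hp μ hf
    simp only [eLpNorm', ENNReal.rpow_one, one_div, inv_one] at h1
    calc ‖∫ x, f x ∂μ‖ₑ ^ p ≤ ((∫⁻ x, ‖f x‖ₑ ^ p ∂μ) ^ p⁻¹) ^ p := by
          gcongr
          exact (enorm_integral_le_lintegral_enorm f).trans h1
      _ = _ := ENNReal.rpow_inv_rpow hp0.ne' _
  -- Without measurability the Bochner integral is 0 by convention.
  · rw [integral_non_aestronglyMeasurable hf]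
    simp [hp0]

/-- Convexity of $t\mapsto t^p$ applied to $l\cdot(a/l)+m\cdot(b/m)$. -/
theorem add_rpow_le_mul_add_mul {l m : ℝ≥0∞} (hlm : l + m = 1) (hl : l ≠ 0) (hm : m ≠ 0)
    (hp : 1 ≤ p) (a b : ℝ≥0∞) : (a + b) ^ p ≤ l ^ (1 - p) * a ^ p + m ^ (1 - p) * b ^ p := by
  have hlt : l ≠ ⊤ := fun h => by simp [h] at hlm
  have hmt : m ≠ ⊤ := fun h => by simp [h] at hlm
  have hscale : ∀ {c : ℝ≥0∞}, c ≠ 0 → c ≠ ⊤ → ∀ z, c * (c⁻¹ * z) ^ p = c ^ (1 - p) * z ^ p := by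
    intro c h0 ht z
    rw [ENNReal.mul_rpow_of_nonneg _ _ (by linarith), ← mul_assoc, ENNReal.inv_rpow,
      ← ENNReal.rpow_neg, sub_eq_add_neg, ENNReal.rpow_add _ _ h0 ht, ENNReal.rpow_one]
  have := ENNReal.rpow_arith_mean_le_arith_mean2_rpow l m (l⁻¹ * a) (m⁻¹ * b) hlm hp
  rwa [hscale hl hlt, hscale hm hmt, ← mul_assoc, ← mul_assoc, ENNReal.mul_inv_cancel hl hlt,
    ENNReal.mul_inv_cancel hm hmt, one_mul, one_mul] at this

/-- Translations are continuous in `L^p`. -/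
theorem exists_translation_le {E : Type*} [NormedAddCommGroup E] (hp : 1 ≤ p) {g : Rd d → E}
    (hg : MemLp g (ENNReal.ofReal p) volume) {η : ℝ≥0∞} (hη : η ≠ 0) :
    ∃ δ > (0 : ℝ), ∀ k : Rd d, ‖k‖ ≤ δ → ∫⁻ x, ‖g (x + k) - g x‖ₑ ^ p ≤ η := by
  have hp0 : 0 < p := by linarith
  have : Fact (1 ≤ ENNReal.ofReal p) := ⟨by simpa using hp⟩
  have : Fact (ENNReal.ofReal p ≠ ⊤) := ⟨ENNReal.ofReal_ne_top⟩
  set F := hg.toLp g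
  -- The additive group acts continuously on $L^p$ by translations; continuity at 0 is the claim.
  have hcont : Continuous fun k : Rd d => (DomAddAct.mk k) +ᵥ F :=
    DomAddAct.continuous_mk.vadd continuous_const
  have h0 : DomAddAct.mk (0 : Rd d) +ᵥ F = F := by simp
  have ht := hcont.tendsto 0
  rw [h0, EMetric.tendsto_nhds] at ht
  have hη' : 0 < η ^ (1 / p) := by
    rcases eq_or_ne η ⊤ with rfl | h
    · simp [hp0]
    · exact ENNReal.rpow_pos (pos_iff_ne_zero.2 hη) h
  obtain ⟨δ, hδ, hball⟩ := Metric.eventually_nhds_iff.1 (ht _ hη')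
  refine ⟨δ / 2, by positivity, fun k hk => ?_⟩
  have h1 := hball (y := k) (by rw [dist_zero_right]; linarith)
  rw [DomAddAct.mk_vadd_toLp, Lp.edist_toLp_toLp,
    eLpNorm_eq_lintegral_rpow_enorm_toReal (by simpa using hp0) ENNReal.ofReal_ne_top,
    ENNReal.toReal_ofReal hp0.le] at h1
  have h2 := (ENNReal.rpow_lt_rpow_iff (by positivity)).1 h1
  simpa [add_comm k] using h2.le

/-- Translations of a weakly differentiable function are controlled by its directional derivative,
up to the modulus of continuity of translations of its gradient. -/
theorem IsWeakGrad.translationEnergy_le (hp : 1 ≤ p) {v : Rd d → ℝ} {g : Rd d → Rd d}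
    (hv : IsWeakGrad univ v g) (hgm : StronglyMeasurable g) {δ : ℝ} {η : ℝ≥0∞}
    (hη : ∀ k : Rd d, ‖k‖ ≤ δ → ∫⁻ x, ‖g (x + k) - g x‖ₑ ^ p ≤ η) {l m : ℝ≥0∞}
    (hlm : l + m = 1) (hl : l ≠ 0) (hm : m ≠ 0) {h : Rd d} (hh : ‖h‖ ≤ δ) :
    translationEnergy p Ω v h ≤ l ^ (1 - p) * (∫⁻ x in Ω, ‖inner ℝ h (g x)‖ₑ ^ p) +
      m ^ (1 - p) * (‖h‖ₑ ^ p * η) := by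
  have hp0 : 0 < p := by linarith
  have hmt : m ≠ ⊤ := fun h => by simp [h] at hlm
  have hlt : l ≠ ⊤ := fun h => by simp [h] at hlm
  have hg' := hgm.measurable
  -- The error from replacing $g(x+th)$ by $g(x)$, after Cauchy–Schwarz. Since $|th|\le\delta$, each
  -- $t$-slice is controlled by `hη`.
  set D : Rd d → ℝ≥0∞ := fun x => ∫⁻ t in Ioc (0 : ℝ) 1, (‖h‖ₑ * ‖g (x + t • h) - g x‖ₑ) ^ p
  have hDm : Measurable D := by
    refine Measurable.lintegral_prod_right
      (f := fun (x : Rd d) (t : ℝ) => (‖h‖ₑ * ‖g (x + t • h) - g x‖ₑ) ^ p) ?_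
    simp only [Function.uncurry_def]
    fun_prop
  have hD : ∫⁻ x, D x ≤ ‖h‖ₑ ^ p * η := by
    have : AEMeasurable (Function.uncurry fun (x : Rd d) (t : ℝ) =>
        (‖h‖ₑ * ‖g (x + t • h) - g x‖ₑ) ^ p) (volume.prod (volume.restrict (Ioc 0 1))) := by
      refine Measurable.aemeasurable ?_
      simp only [Function.uncurry_def]
      fun_prop
    rw [lintegral_lintegral_swap this]
    calc ∫⁻ t in Ioc (0 : ℝ) 1, ∫⁻ x, (‖h‖ₑ * ‖g (x + t • h) - g x‖ₑ) ^ p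
        ≤ ∫⁻ t in Ioc (0 : ℝ) 1, ‖h‖ₑ ^ p * η := by
          refine setLIntegral_mono' measurableSet_Ioc fun t ht => ?_
          simp only [ENNReal.mul_rpow_of_nonneg _ _ hp0.le]
          rw [lintegral_const_mul _ (by fun_prop)]
          gcongr
          refine hη _ (le_trans ?_ hh)
          rw [norm_smul, Real.norm_eq_abs, abs_of_pos ht.1]
          exact mul_le_of_le_one_left (norm_nonneg _) ht.2
      _ = _ := by simp
  have hpt : ∀ᵐ x : Rd d, ‖v (x + h) - v x‖ₑ ^ p ≤
      l ^ (1 - p) * ‖inner ℝ h (g x)‖ₑ ^ p + m ^ (1 - p) * D x := by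
    filter_upwards [hv.ae_sub_eq_integral hgm h,
      ae_integrable_comp_add_smul hgm (locallyIntegrableOn_univ.1 hv.locInt_grad) h] with x hx hxi
    have e1 : ∫ t in Ioc (0 : ℝ) 1, inner ℝ h (g (x + t • h)) =
        inner ℝ h (g x) + ∫ t in Ioc (0 : ℝ) 1, inner ℝ h (g (x + t • h) - g x) := by
      simp only [inner_sub_right]
      rw [integral_sub (hxi.const_inner h) (integrable_const _)]
      simp
    rw [hx, e1]
    refine le_trans (ENNReal.rpow_le_rpow (enorm_add_le _ _) hp0.le) ?_
    refine (add_rpow_le_mul_add_mul hlm hl hm hp _ _).trans ?_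
    gcongr
    refine (enorm_integral_rpow_le hp _).trans (lintegral_mono fun t => ?_)
    gcongr
    rw [← ofReal_norm, ← ofReal_norm, ← ofReal_norm, ← ENNReal.ofReal_mul (norm_nonneg _)]
    exact ENNReal.ofReal_le_ofReal (norm_inner_le_norm _ _)
  calc translationEnergy p Ω v h
      ≤ ∫⁻ x in Ω, l ^ (1 - p) * ‖inner ℝ h (g x)‖ₑ ^ p + m ^ (1 - p) * D x :=
        lintegral_mono_ae (ae_restrict_of_ae hpt)
    _ = l ^ (1 - p) * (∫⁻ x in Ω, ‖inner ℝ h (g x)‖ₑ ^ p) + m ^ (1 - p) * ∫⁻ x in Ω, D x := by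
        rw [lintegral_add_left (by fun_prop), lintegral_const_mul _ (by fun_prop),
          lintegral_const_mul _ hDm]
    _ ≤ _ := by
        gcongr
        exact (setLIntegral_le_lintegral _ _).trans hD

/-- The weights $l=1-1/(n+2)$ suffice, as $l^{1-p}\to1$; the shift by 2 keeps $l\ne0$ already at
$n=0$. -/
theorem le_of_forall_le_rpow_mul {a b : ℝ≥0∞}
    (h : ∀ l m : ℝ≥0∞, l + m = 1 → l ≠ 0 → m ≠ 0 → a ≤ l ^ (1 - p) * b) : a ≤ b := by
  have hcont : Tendsto (fun n : ℕ => (1 - (n + 2 : ℝ≥0∞)⁻¹) ^ (1 - p) * b) atTop (𝓝 b) := by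
    have h1 : Tendsto (fun n : ℕ => ((n : ℝ≥0∞) + 2)⁻¹) atTop (𝓝 0) := by
      have := (tendsto_add_atTop_iff_nat 2).2 ENNReal.tendsto_inv_nat_nhds_zero
      simpa using this
    have h2 : Tendsto (fun n : ℕ => (1 - (n + 2 : ℝ≥0∞)⁻¹)) atTop (𝓝 1) := by
      simpa using ENNReal.Tendsto.sub (tendsto_const_nhds (x := (1 : ℝ≥0∞))) h1 (Or.inl (by simp))
    have h3 := (ENNReal.continuous_rpow_const (y := 1 - p)).tendsto 1 |>.comp h2
    rw [ENNReal.one_rpow] at h3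
    simpa using ENNReal.Tendsto.mul_const (b := b) h3 (Or.inl one_ne_zero)
  refine ge_of_tendsto' hcont fun n => ?_
  have hlt : ((n : ℝ≥0∞) + 2)⁻¹ < 1 := by
    rw [ENNReal.inv_lt_one]
    exact lt_of_lt_of_le (by norm_num) (le_add_self)
  refine h _ ((n : ℝ≥0∞) + 2)⁻¹ (tsub_add_cancel_of_le hlt.le) (tsub_pos_of_lt hlt).ne' ?_
  exact ENNReal.inv_ne_zero.2 (by finiteness)

/-- The limit superior for functions of `W^{1,p}(ℝ^d)`. -/
theorem limsup_nonlocalEnergy_le_gradient (hp : 1 ≤ p) {e : Rd d} (he : ‖e‖ = 1)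
    {ν : ℝ → Rd d → ℝ≥0∞} (hν : IsPLevyApprox p ν) {v : Rd d → ℝ} {g : Rd d → Rd d}
    (hvm : Measurable v) (hvp : MemLp v (ENNReal.ofReal p) volume)
    (hv : IsWeakGrad univ v g) (hgp : MemLp g (ENNReal.ofReal p) volume) :
    limsup (fun ε : ℝ => nonlocalEnergy p (ν ε) Ω v) (𝓝[>] 0) ≤
      sphereMean e p * ∫⁻ x in Ω, ‖g x‖ₑ ^ p := by
  have hp0 : 0 < p := by linarith
  -- A strongly measurable representative makes $(x,t)\mapsto g(x+th)$ measurable.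
  wlog hgm : StronglyMeasurable g generalizing g
  · have hae := hgp.aestronglyMeasurable.ae_eq_mk
    have h1 := this (g := hgp.aestronglyMeasurable.mk g)
      (hv.congr_grad (by rwa [Measure.restrict_univ])) ((memLp_congr_ae hae).1 hgp)
      hgp.aestronglyMeasurable.stronglyMeasurable_mk
    refine h1.trans_eq ?_
    congr 1
    refine lintegral_congr_ae ?_
    filter_upwards [ae_restrict_of_ae hae] with x hx
    rw [hx]
  have hvfin : ∫⁻ x, ‖v x‖ₑ ^ p ≠ ⊤ := by
    have := lintegral_rpow_enorm_lt_top_of_eLpNorm_lt_top (by simpa using hp0)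
      ENNReal.ofReal_ne_top hvp.eLpNorm_lt_top
    rw [ENNReal.toReal_ofReal hp0.le] at this
    exact this.ne
  have hgm' := hgm.measurable
  refine le_of_forall_le_rpow_mul (p := p) fun l m hlm hl hm => ?_
  have hmt : m ≠ ⊤ := fun h => by simp [h] at hlm
  have hlt : l ≠ ⊤ := fun h => by simp [h] at hlm
  have hlp : l ^ (1 - p) ≠ ⊤ := by simp [ENNReal.rpow_eq_top_iff, hl, hlt]
  have hmp : m ^ (1 - p) ≠ ⊤ := by simp [ENNReal.rpow_eq_top_iff, hm, hmt]
  have hmp0 : m ^ (1 - p) ≠ 0 := by simp [ENNReal.rpow_eq_zero_iff, hm, hmt]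
  refine ENNReal.le_of_forall_pos_le_add fun κ hκ _ => ?_
  -- The modulus is chosen so that $m^{1-p}\eta=\kappa$.
  obtain ⟨δ, hδ, hη⟩ := exists_translation_le hp hgp (η := (m ^ (1 - p))⁻¹ * κ)
    (mul_ne_zero (ENNReal.inv_ne_zero.2 hmp) (by simpa using hκ.ne'))
  refine limsup_nonlocalEnergy_le hp hν hvm hvfin (lt_min hδ one_pos) fun ε hε => ?_
  have hms : MeasurableSet {h : Rd d | ‖h‖ ≤ min δ 1} :=
    measurableSet_le measurable_norm measurable_const
  have hmeas : AEMeasurable (fun h : Rd d => ν ε h * ∫⁻ x in Ω, ‖inner ℝ h (g x)‖ₑ ^ p)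
      (volume.restrict {h : Rd d | ‖h‖ ≤ min δ 1}) := by
    refine (hν.measurable ε hε).restrict.mul (Measurable.aemeasurable ?_)
    refine Measurable.lintegral_prod_right
      (f := fun h x : Rd d => ‖inner ℝ h (g x)‖ₑ ^ p) ?_
    simp only [Function.uncurry_def]
    fun_prop
  calc ∫⁻ h in {h : Rd d | ‖h‖ ≤ min δ 1}, ν ε h * translationEnergy p Ω v h
      ≤ ∫⁻ h in {h : Rd d | ‖h‖ ≤ min δ 1},
          (l ^ (1 - p) * (ν ε h * ∫⁻ x in Ω, ‖inner ℝ h (g x)‖ₑ ^ p) + κ * (ν ε h * ‖h‖ₑ ^ p)) := by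
        refine setLIntegral_mono' hms fun h hh => ?_
        refine (mul_le_mul_right (hv.translationEnergy_le hp hgm hη hlm hl hm
          (le_trans hh (min_le_left _ _))) _).trans_eq ?_
        have : m ^ (1 - p) * (‖h‖ₑ ^ p * ((m ^ (1 - p))⁻¹ * κ)) = κ * ‖h‖ₑ ^ p := by
          calc _ = (m ^ (1 - p) * (m ^ (1 - p))⁻¹) * (κ * ‖h‖ₑ ^ p) := by ring
            _ = _ := by rw [ENNReal.mul_inv_cancel hmp0 hmp, one_mul]
        rw [this]
        ring
    _ = l ^ (1 - p) * (∫⁻ h in {h : Rd d | ‖h‖ ≤ min δ 1},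
          ν ε h * ∫⁻ x in Ω, ‖inner ℝ h (g x)‖ₑ ^ p) +
        κ * ∫⁻ h in {h : Rd d | ‖h‖ ≤ min δ 1}, ν ε h * ‖h‖ₑ ^ p := by
        rw [lintegral_add_left' (hmeas.const_mul _), lintegral_const_mul' _ _ hlp,
          lintegral_const_mul' _ _ ENNReal.coe_ne_top]
    _ ≤ l ^ (1 - p) * (sphereMean e p * ∫⁻ x in Ω, ‖g x‖ₑ ^ p) + κ * 1 := by
        gcongr
        · exact hν.lintegral_inner_le hp0 he hε (min_le_right _ _) hgm'.aemeasurable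
        · exact hν.lintegral_norm_le_one hp0.le hε (min_le_right _ _)
    _ = _ := by rw [mul_one]

/-- Finite gradient energy puts $u$ in $W^{1,p}(\Omega)$, so it can be extended; uniqueness of weak
gradients identifies the gradient of the extension on $\Omega$ with that of $u$. -/
theorem limsup_nonlocalEnergy_le_of_memW1p (hp : 1 ≤ p) {e : Rd d} (he : ‖e‖ = 1)
    {ν : ℝ → Rd d → ℝ≥0∞} (hν : IsPLevyApprox p ν) (hΩ : IsW1pExtensionDomain p Ω)
    {u : Rd d → ℝ} (hu : MemLp u (ENNReal.ofReal p) (volume.restrict Ω)) :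
    limsup (fun ε : ℝ => nonlocalEnergy p (ν ε) Ω u) (𝓝[>] 0) ≤
      sphereMean e p * gradEnergy p Ω u := by
  have hp0 : 0 < p := by linarith
  obtain ⟨hopen, T, C, hT⟩ := hΩ
  have hK := sphereMean_ne_zero he hp0
  rcases eq_or_ne (gradEnergy p Ω u) ⊤ with htop | htop
  · rw [htop, ENNReal.mul_top hK]
    exact le_top
  have hmem : MemW1p p Ω u := by
    by_contra hcon
    refine htop (iInf₂_eq_top.2 fun g hg => ?_)
    by_contra hfin
    refine hcon ⟨hu, g, hg, hg.locInt_grad.aestronglyMeasurable, ?_⟩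
    refine (eLpNorm_lt_top_iff_lintegral_rpow_enorm_lt_top (by simpa using hp0)
      ENNReal.ofReal_ne_top).2 ?_
    rw [ENNReal.toReal_ofReal hp0.le]
    exact lt_top_iff_ne_top.2 hfin
  have hU : MemW1p p Ω (hu.toLp u) := by
    obtain ⟨h1, g, h2, h3⟩ := hmem
    exact ⟨Lp.memLp _, g, h2.congr hu.coeFn_toLp.symm, h3⟩
  obtain ⟨hTu, -⟩ := hT ⟨hu.toLp u, hU⟩
  set V := (T ⟨hu.toLp u, hU⟩).1
  have huv : u =ᵐ[volume.restrict Ω] V := hu.coeFn_toLp.symm.trans hTu.symm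
  obtain ⟨hVp, g, hVg, hgp⟩ : MemW1p p univ V := (T ⟨hu.toLp u, hU⟩).2
  rw [Measure.restrict_univ] at hgp
  have hVp' : MemLp V (ENNReal.ofReal p) (volume : Measure (Rd d)) := by
    simpa only [Measure.restrict_univ] using hVp
  simp only [nonlocalEnergy_congr _ huv]
  refine (limsup_nonlocalEnergy_le_gradient hp he hν (Lp.stronglyMeasurable V).measurable hVp'
    hVg hgp).trans ?_
  gcongr
  refine le_iInf₂ fun k hk => ?_
  refine le_of_eq (lintegral_congr_ae ?_)
  filter_upwards [((hVg.mono (subset_univ Ω)).congr huv.symm).ae_eq hopen hk] with x hx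
  rw [hx]

end Sobolev

/-! ### Localization of the total variation -/

section Variation

variable {d : ℕ}

theorem le_bvSeminorm {Ω : Set (Rd d)} (u : Rd d → ℝ) {φ : Rd d → Rd d} (hφ : IsTestField Ω φ) :
    ENNReal.ofReal (∫ x in Ω, u x * divergence φ x) ≤ bvSeminorm Ω u :=
  le_iSup₂ (f := fun (φ : Rd d → Rd d) (_ : IsTestField Ω φ) =>
      ENNReal.ofReal (∫ x in Ω, u x * divergence φ x)) φ hφ

theorem tsupport_divergence_subset (φ : Rd d → Rd d) : tsupport (divergence φ) ⊆ tsupport φ := by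
  refine closure_minimal (fun x hx => ?_) isClosed_closure
  by_contra h
  refine hx ?_
  have : fderiv ℝ φ x = 0 := image_eq_zero_of_notMem_tsupport
    fun h' => h (tsupport_fderiv_subset ℝ h')
  simp [divergence, this]

theorem IsTestField.setIntegral_eq {Ω : Set (Rd d)} {φ : Rd d → Rd d} (hφ : IsTestField Ω φ)
    (u : Rd d → ℝ) : ∫ x in Ω, u x * divergence φ x = ∫ x, u x * divergence φ x :=
  setIntegral_eq_of_tsupport_subset
    ((tsupport_mul_subset_right.trans (tsupport_divergence_subset φ)).trans hφ.support_subset)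

theorem IsTestField.mono {U V : Set (Rd d)} {φ : Rd d → Rd d} (hφ : IsTestField U φ)
    (h : U ⊆ V) : IsTestField V φ :=
  ⟨hφ.smooth, hφ.compact, hφ.support_subset.trans h, hφ.norm_le⟩

theorem bvSeminorm_mono {U V : Set (Rd d)} (h : U ⊆ V) (u : Rd d → ℝ) :
    bvSeminorm U u ≤ bvSeminorm V u := by
  refine iSup₂_le fun φ hφ => ?_
  rw [hφ.setIntegral_eq, ← (hφ.mono h).setIntegral_eq]
  exact le_bvSeminorm u (hφ.mono h)

theorem IsTestField.integrable {Ω : Set (Rd d)} {φ : Rd d → Rd d} (hφ : IsTestField Ω φ)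
    {u : Rd d → ℝ} (hu : Integrable u) : Integrable (fun x => u x * divergence φ x) := by
  have hu' : MemLp u 1 (volume.restrict univ) := by
    rw [Measure.restrict_univ]
    exact memLp_one_iff_integrable.2 hu
  have := integrable_mul_divergence hu' (hφ.mono (subset_univ Ω))
  rwa [Measure.restrict_univ] at this

theorem divergence_add {φ ψ : Rd d → Rd d} (hφ : ContDiff ℝ ∞ φ) (hψ : ContDiff ℝ ∞ ψ) (x : Rd d) :
    divergence (fun y => φ y + ψ y) x = divergence φ x + divergence ψ x := by
  simp only [divergence, ← Finset.sum_add_distrib]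
  refine Finset.sum_congr rfl fun i _ => ?_
  rw [fderiv_fun_add (hφ.differentiable (by simp) x) (hψ.differentiable (by simp) x)]
  rfl

/-- Smooth cutoff functions. -/
theorem exists_smooth_cutoff {K U : Set (Rd d)} (hK : IsCompact K) (hU : IsOpen U) (hKU : K ⊆ U) :
    ∃ χ : Rd d → ℝ, ContDiff ℝ ∞ χ ∧ HasCompactSupport χ ∧ tsupport χ ⊆ U ∧
      (∀ x, χ x ∈ Icc (0 : ℝ) 1) ∧ ∀ᶠ x in 𝓝ˢ K, χ x = 1 := by
  obtain ⟨L, hL, hKL, hLU⟩ := exists_compact_between hK hU hKU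
  obtain ⟨f, h1, h0, hf⟩ := exists_contMDiffMap_one_nhds_of_subset_interior
    (modelWithCornersSelf ℝ (Rd d)) (n := ⊤) hK.isClosed hKL
  have hsupp : tsupport f ⊆ L := closure_minimal
    (fun x hx => by_contra fun h => hx (h0 x h)) hL.isClosed
  exact ⟨f, f.contMDiff.contDiff, hL.of_isClosed_subset isClosed_closure hsupp,
    hsupp.trans hLU, hf, h1⟩

theorem IsTestField.cutoff {Ω U : Set (Rd d)} {φ : Rd d → Rd d} (hφ : IsTestField Ω φ)
    {χ : Rd d → ℝ} (hχ : ContDiff ℝ ∞ χ) (h01 : ∀ x, χ x ∈ Icc (0 : ℝ) 1)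
    (hs : tsupport (fun x => χ x • φ x) ⊆ U) : IsTestField U (fun x => χ x • φ x) where
  smooth := hχ.smul hφ.smooth
  compact := hφ.compact.mono fun x hx h0 => hx (by simp [h0])
  support_subset := hs
  norm_le x := by
    rw [norm_smul, Real.norm_eq_abs, abs_of_nonneg (h01 x).1]
    exact mul_le_one₀ (h01 x).2 (norm_nonneg _) (hφ.norm_le x)

/-- The total variation is subadditive on open sets. -/
theorem bvSeminorm_union_le {U V : Set (Rd d)} (hU : IsOpen U) (hV : IsOpen V) {u : Rd d → ℝ}
    (hu : Integrable u) : bvSeminorm (U ∪ V) u ≤ bvSeminorm U u + bvSeminorm V u := by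
  refine iSup₂_le fun φ hφ => ?_
  -- This compact set lies in `U`. A cutoff `χ` equal to 1 near it and supported in `U` splits `φ`
  -- into fields admissible for `U` and for `V`.
  have hK : IsCompact (tsupport φ \ V) := IsCompact.diff hφ.compact hV
  obtain ⟨χ, hχ, -, hχU, h01, h1⟩ := exists_smooth_cutoff hK hU fun x hx =>
    (hφ.support_subset hx.1).resolve_right hx.2
  have hφ1 : IsTestField U (fun x => χ x • φ x) :=
    hφ.cutoff hχ h01 ((tsupport_smul_subset_left _ _).trans hχU)
  have hφ2 : IsTestField V (fun x => (1 - χ x) • φ x) := by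
    refine hφ.cutoff (contDiff_const.sub hχ) (fun x => ?_) fun x hx => ?_
    · have := h01 x
      exact ⟨by linarith [this.2], by linarith [this.1]⟩
    · by_contra hxV
      have hxK : x ∈ tsupport φ \ V := ⟨tsupport_smul_subset_right _ _ hx, hxV⟩
      have : ∀ᶠ y in 𝓝 x, χ y = 1 := h1.filter_mono (nhds_le_nhdsSet hxK)
      refine notMem_tsupport_iff_eventuallyEq.2 ?_ hx
      filter_upwards [this] with y hy
      simp [hy]
  have hsum : ∀ x, divergence φ x =
      divergence (fun x => χ x • φ x) x + divergence (fun x => (1 - χ x) • φ x) x := by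
    intro x
    rw [← divergence_add hφ1.smooth hφ2.smooth]
    congr 1
    ext y
    simp
  rw [hφ.setIntegral_eq]
  simp only [hsum, mul_add]
  rw [integral_add (hφ1.integrable hu) (hφ2.integrable hu), ← hφ1.setIntegral_eq,
    ← hφ2.setIntegral_eq]
  exact ENNReal.ofReal_add_le.trans (add_le_add (le_bvSeminorm u hφ1) (le_bvSeminorm u hφ2))

/-- The total variation is small near infinity. -/
theorem exists_bvSeminorm_compl_ball_le {u : Rd d → ℝ} (hu : Integrable u)
    (hfin : bvSeminorm univ u ≠ ⊤) {η : ℝ≥0∞} (hη : η ≠ 0) :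
    ∃ R : ℝ, bvSeminorm {x : Rd d | R < ‖x‖} u ≤ η := by
  rcases le_or_gt (bvSeminorm univ u) η with hle | hlt
  · exact ⟨0, (bvSeminorm_mono (subset_univ _) u).trans hle⟩
  have hb : bvSeminorm univ u - η < bvSeminorm univ u :=
    ENNReal.sub_lt_self hfin (zero_le.trans_lt hlt).ne' hη
  -- Take `φ` within `η` of the supremum. A field `ψ` living outside a ball containing its support
  -- can be added without violating the norm bound, so `ψ` gains at most `η`.
  obtain ⟨φ, hb⟩ := lt_iSup_iff.1 hb
  obtain ⟨hφ, hb⟩ := lt_iSup_iff.1 hb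
  obtain ⟨R, hR⟩ := hφ.compact.isBounded.subset_closedBall (0 : Rd d)
  refine ⟨R, iSup₂_le fun ψ hψ => ?_⟩
  have hdisj : ∀ x, φ x = 0 ∨ ψ x = 0 := by
    intro x
    by_contra! h
    have h1 := mem_closedBall_zero_iff.1 (hR (subset_tsupport _ h.1))
    exact absurd (hψ.support_subset (subset_tsupport _ h.2)) (not_lt.2 h1)
  have hsum : IsTestField univ (fun x => φ x + ψ x) :=
    ⟨hφ.smooth.add hψ.smooth, hφ.compact.add hψ.compact, subset_univ _, fun x => by
      rcases hdisj x with h | h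
      · simpa [h] using hψ.norm_le x
      · simpa [h] using hφ.norm_le x⟩
  have h1 := le_bvSeminorm u hsum
  rw [hsum.setIntegral_eq] at h1
  simp only [divergence_add hφ.smooth hψ.smooth, mul_add] at h1
  rw [integral_add (hφ.integrable hu) (hψ.integrable hu)] at h1
  rw [hφ.setIntegral_eq] at hb
  rw [hψ.setIntegral_eq]
  have hφpos : 0 < ∫ x, u x * divergence φ x := ENNReal.ofReal_pos.1 (zero_le.trans_lt hb)
  rcases le_total (∫ x, u x * divergence ψ x) 0 with h0 | h0
  · rw [ENNReal.ofReal_of_nonpos h0]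
    exact zero_le
  rw [ENNReal.ofReal_add hφpos.le h0] at h1
  exact (ENNReal.add_le_add_iff_left ENNReal.ofReal_ne_top).1
    (h1.trans (tsub_le_iff_right.1 hb.le))

/-- If the variation measure does not charge the boundary, then the total variation on small
neighbourhoods of `Ω` is close to the total variation on `Ω`. -/
theorem exists_bvSeminorm_thickening_le {Ω : Set (Rd d)} (hΩ : IsOpen Ω) {u : Rd d → ℝ}
    (hu : Integrable u) (hfin : bvSeminorm univ u ≠ ⊤)
    (hbd : variationMeasure u (frontier Ω) = 0) {η : ℝ≥0∞} (hη : η ≠ 0) :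
    ∃ δ > (0 : ℝ), bvSeminorm (Metric.thickening δ Ω) u ≤ bvSeminorm Ω u + η := by
  have hη2 : η / 2 ≠ 0 := by simpa using hη
  have h1 : variationMeasure u (frontier Ω) < η / 2 := by
    rw [hbd]
    exact pos_iff_ne_zero.2 hη2
  simp only [variationMeasure, iInf_lt_iff] at h1
  obtain ⟨U, hU, hUΩ, hUη⟩ := h1
  -- When $\Omega$ is unbounded, `U` need not contain a uniform neighbourhood of the boundary.
  -- Compactness provides one in a bounded region, and the variation beyond radius `R` is small.
  obtain ⟨R, hR⟩ := exists_bvSeminorm_compl_ball_le hu hfin hη2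
  have hK : IsCompact (closure Ω ∩ Metric.closedBall (0 : Rd d) (R + 1)) :=
    (isCompact_closedBall _ _).inter_left isClosed_closure
  have hKU : closure Ω ∩ Metric.closedBall (0 : Rd d) (R + 1) ⊆ Ω ∪ U := by
    intro x hx
    rcases (closure_eq_self_union_frontier Ω ▸ hx.1 : x ∈ Ω ∪ frontier Ω) with h | h
    · exact Or.inl h
    · exact Or.inr (hUΩ h)
  obtain ⟨δ, hδ, hδU⟩ := hK.exists_thickening_subset_open (hΩ.union hU) hKU
  have hopen : IsOpen {x : Rd d | R < ‖x‖} := isOpen_lt continuous_const continuous_norm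
  -- The cap 1 matches the radius `R + 1`: a point of norm at most `R` has its nearby point of
  -- $\Omega$ inside that larger ball.
  refine ⟨min δ 1, by positivity, ?_⟩
  have hsub : Metric.thickening (min δ 1) Ω ⊆ Ω ∪ (U ∪ {x : Rd d | R < ‖x‖}) := by
    intro x hx
    rw [← union_assoc]
    rcases lt_or_ge R ‖x‖ with h | h
    · exact Or.inr h
    · left
      obtain ⟨y, hy, hxy⟩ := Metric.mem_thickening_iff.1 hx
      refine hδU (Metric.mem_thickening_iff.2 ⟨y, ⟨subset_closure hy, ?_⟩,
        hxy.trans_le (min_le_left _ _)⟩)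
      rw [mem_closedBall_zero_iff]
      have h2 : ‖y - x‖ ≤ 1 := by
        rw [← dist_eq_norm, dist_comm]
        exact hxy.le.trans (min_le_right _ _)
      calc ‖y‖ = ‖x + (y - x)‖ := by simp
        _ ≤ _ := (norm_add_le _ _).trans (add_le_add h h2)
  calc bvSeminorm (Metric.thickening (min δ 1) Ω) u
      ≤ bvSeminorm Ω u + (bvSeminorm U u + bvSeminorm {x : Rd d | R < ‖x‖} u) :=
        (bvSeminorm_mono hsub u).trans ((bvSeminorm_union_le hΩ (hU.union hopen) hu).trans
          (add_le_add_right (bvSeminorm_union_le hU hopen hu) _))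
    _ ≤ bvSeminorm Ω u + (η / 2 + η / 2) := by gcongr
    _ = _ := by rw [ENNReal.add_halves]

end Variation

/-! ### Smooth functions -/

section Smooth

variable {d : ℕ}

theorem inner_gradient {w : Rd d → ℝ} (v x : Rd d) : inner ℝ v (gradient w x) = fderiv ℝ w x v := by
  rw [real_inner_comm, ← toDual_gradient, InnerProductSpace.toDual_apply_apply]

theorem contDiff_gradient {w : Rd d → ℝ} (hw : ContDiff ℝ ∞ w) : ContDiff ℝ ∞ (gradient w) :=
  (InnerProductSpace.toDual ℝ (Rd d)).symm.contDiff.comp (hw.fderiv_right (by simp))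

/-- The classical gradient is the weak gradient. -/
theorem isWeakGrad_gradient {w : Rd d → ℝ} (hw : ContDiff ℝ ∞ w) :
    IsWeakGrad univ w (gradient w) where
  locInt := hw.continuous.locallyIntegrable.locallyIntegrableOn _
  locInt_grad := (contDiff_gradient hw).continuous.locallyIntegrable.locallyIntegrableOn _
  integral_eq φ h1 h2 _ i := by
    have hw' := hw.continuous
    have hφ' := h1.continuous
    have e : ∀ x, gradient w x i = fderiv ℝ w x (stdVec i) := by
      intro x
      rw [← inner_gradient, EuclideanSpace.inner_single_left]
      simp
    simp only [Measure.restrict_univ, e]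
    refine integral_mul_fderiv_eq_neg_fderiv_mul_of_integrable ?_ ?_ ?_ ?_ ?_
    · exact ((continuous_partial hw _).mul hφ').integrable_of_hasCompactSupport h2.mul_left
    · exact (hw'.mul (continuous_partial h1 _)).integrable_of_hasCompactSupport
        (h2.fderiv_apply (𝕜 := ℝ) _).mul_left
    · exact (hw'.mul hφ').integrable_of_hasCompactSupport h2.mul_left
    · exact fun x _ => hw.differentiable (by simp) x
    · exact fun x _ => h1.differentiable (by simp) x

theorem contDiff_coord {φ : Rd d → Rd d} (hφ : ContDiff ℝ ∞ φ) (i : Fin d) :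
    ContDiff ℝ ∞ (fun x => φ x i) :=
  (EuclideanSpace.proj (𝕜 := ℝ) i : Rd d →L[ℝ] ℝ).contDiff.comp hφ

theorem fderiv_coord {φ : Rd d → Rd d} (hφ : ContDiff ℝ ∞ φ) (i : Fin d) (x v : Rd d) :
    fderiv ℝ (fun x => φ x i) x v = fderiv ℝ φ x v i := by
  have h := (EuclideanSpace.proj (𝕜 := ℝ) i : Rd d →L[ℝ] ℝ).hasFDerivAt.comp x
    (hφ.differentiable (by simp) x).hasFDerivAt
  have h' : HasFDerivAt (fun x => φ x i)
      ((EuclideanSpace.proj (𝕜 := ℝ) i : Rd d →L[ℝ] ℝ).comp (fderiv ℝ φ x)) x := h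
  rw [h'.fderiv]
  rfl

theorem IsWeakGrad.integral_mul_divergence {Ω : Set (Rd d)} {u : Rd d → ℝ} {g : Rd d → Rd d}
    (h : IsWeakGrad univ u g) {φ : Rd d → Rd d} (hφ : IsTestField Ω φ) :
    ∫ x, u x * divergence φ x = - ∫ x, inner ℝ (g x) (φ x) := by
  have hc : ∀ i, HasCompactSupport (fun x => φ x i) := fun i =>
    hφ.compact.mono fun x hx h0 => hx (by simp [h0])
  have hs : ∀ i, ContDiff ℝ ∞ (fun x => φ x i) := contDiff_coord hφ.smooth
  simp only [divergence, ← fderiv_coord hφ.smooth, Finset.mul_sum]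
  have hi : ∀ x, inner ℝ (g x) (φ x) = ∑ i, g x i * φ x i := by
    intro x
    simp [PiLp.inner_apply, mul_comm]
  simp only [hi]
  rw [integral_finsetSum, integral_finsetSum, ← Finset.sum_neg_distrib]
  · refine Finset.sum_congr rfl fun i _ => ?_
    simpa using h.integral_eq _ (hs i) (hc i) (subset_univ _) i
  · intro i _
    simpa using integrable_mul_of_locInt (locInt_coord h.locInt_grad i) (hs i).continuous (hc i)
      (subset_univ _)
  · intro i _
    simpa using integrable_mul_partial h.locInt (hs i) (hc i) (subset_univ _) (stdVec i)

/-- Replacing $|\nabla w|$ by $\sqrt{|\nabla w|^2+\eta^2}$ in a denominator keeps the normalized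
gradient smooth at critical points; the loss is at most $\eta$. -/
theorem sub_le_sq_div_sqrt {s η : ℝ} (hs : 0 ≤ s) (hη : 0 < η) :
    s - η ≤ s ^ 2 / √(s ^ 2 + η ^ 2) := by
  have h0 : 0 < √(s ^ 2 + η ^ 2) := by positivity
  rw [le_div_iff₀ h0]
  rcases le_total s η with h | h
  · nlinarith
  · have h1 : √(s ^ 2 + η ^ 2) ≤ s + η := by
      rw [Real.sqrt_le_left (by positivity)]
      nlinarith
    nlinarith [mul_le_mul_of_nonneg_left h1 (sub_nonneg.2 h)]

/-- The total variation of a smooth function dominates the integral of the norm of its gradient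
against a cutoff function. -/
theorem ofReal_integral_cutoff_le_bvSeminorm {W : Set (Rd d)} {w : Rd d → ℝ} (hw : ContDiff ℝ ∞ w)
    {χ : Rd d → ℝ} (hχ : ContDiff ℝ ∞ χ) (hc : HasCompactSupport χ) (hs : tsupport χ ⊆ W)
    (h01 : ∀ x, χ x ∈ Icc (0 : ℝ) 1) :
    ENNReal.ofReal (∫ x, χ x * ‖gradient w x‖) ≤ bvSeminorm W w := by
  set G := gradient w
  have hG : ContDiff ℝ ∞ G := contDiff_gradient hw
  have key : ∀ η : ℝ, 0 < η →
      ENNReal.ofReal (∫ x, χ x * ‖G x‖) ≤ bvSeminorm W w + ENNReal.ofReal (η * ∫ x, χ x) := by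
    intro η hη
    set r : Rd d → ℝ := fun x => √(‖G x‖ ^ 2 + η ^ 2)
    have hr0 : ∀ x, 0 < r x := fun x => by positivity
    have hr : ContDiff ℝ ∞ r := ((hG.norm_sq ℝ).add contDiff_const).sqrt fun x => by positivity
    have hcr : ContDiff ℝ ∞ (fun x => - (χ x / r x)) := (hχ.div hr fun x => (hr0 x).ne').neg
    -- The near-optimal field is $-\chi\nabla w/r$, with the minus sign undoing the one from
    -- integration by parts.
    have hφ : IsTestField W (fun x => (- (χ x / r x)) • G x) := by
      refine ⟨hcr.smul hG, hc.mono fun x hx h0 => hx (by simp [h0]), ?_, fun x => ?_⟩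
      · have hsub : Function.support (fun x => (- (χ x / r x)) • G x) ⊆ Function.support χ :=
          fun x hx h0 => hx (by simp [h0])
        exact (closure_mono hsub).trans hs
      · rw [norm_smul, norm_neg, norm_div, Real.norm_of_nonneg (h01 x).1,
          Real.norm_of_nonneg (hr0 x).le, div_mul_eq_mul_div, div_le_one (hr0 x)]
        calc χ x * ‖G x‖ ≤ 1 * ‖G x‖ := by gcongr; exact (h01 x).2
          _ = √(‖G x‖ ^ 2) := by rw [one_mul, Real.sqrt_sq (norm_nonneg _)]
          _ ≤ r x := Real.sqrt_le_sqrt (by nlinarith)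
    have h1 := le_bvSeminorm w hφ
    rw [hφ.setIntegral_eq, (isWeakGrad_gradient hw).integral_mul_divergence hφ,
      ← integral_neg] at h1
    have hGc := hG.continuous
    have hχc := hχ.continuous
    have i1 : Integrable (fun x => χ x * ‖G x‖) :=
      (hχc.mul hGc.norm).integrable_of_hasCompactSupport hc.mul_right
    have i2 : Integrable χ := hχc.integrable_of_hasCompactSupport hc
    have i3 : Integrable (fun x => - inner ℝ (G x) ((- (χ x / r x)) • G x)) := by
      refine Continuous.integrable_of_hasCompactSupport
        (hGc.inner (hcr.continuous.smul hGc)).neg ?_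
      exact hc.mono fun x hx h0 => hx (by simp [h0])
    have h2 : ∫ x, χ x * ‖G x‖ ≤
        (∫ x, - inner ℝ (G x) ((- (χ x / r x)) • G x)) + η * ∫ x, χ x := by
      rw [← integral_const_mul, ← integral_add i3 (i2.const_mul η)]
      refine integral_mono i1 (i3.add (i2.const_mul η)) fun x => ?_
      simp only [inner_smul_right, real_inner_self_eq_norm_sq]
      have := mul_le_mul_of_nonneg_left (sub_le_sq_div_sqrt (norm_nonneg (G x)) hη) (h01 x).1
      calc χ x * ‖G x‖ = χ x * (‖G x‖ - η) + η * χ x := by ring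
        _ ≤ χ x * (‖G x‖ ^ 2 / √(‖G x‖ ^ 2 + η ^ 2)) + η * χ x := by gcongr
        _ = _ := by simp only [r]; ring
    refine (ENNReal.ofReal_le_ofReal h2).trans (ENNReal.ofReal_add_le.trans ?_)
    gcongr
  have hlim : Tendsto (fun η : ℝ => bvSeminorm W w + ENNReal.ofReal (η * ∫ x, χ x)) (𝓝[>] 0)
      (𝓝 (bvSeminorm W w + ENNReal.ofReal (0 * ∫ x, χ x))) := by
    refine Tendsto.mono_left ?_ nhdsWithin_le_nhds
    refine Continuous.tendsto (f := fun η : ℝ => bvSeminorm W w + ENNReal.ofReal (η * ∫ x, χ x)) ?_ 0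
    exact continuous_const.add (ENNReal.continuous_ofReal.comp (continuous_id.mul continuous_const))
  rw [zero_mul, ENNReal.ofReal_zero, add_zero] at hlim
  refine ge_of_tendsto hlim ?_
  filter_upwards [self_mem_nhdsWithin] with η hη
  exact key η hη

/-- `∫_W |∇w| ≤ |w|_{BV(W)}` for smooth `w`. -/
theorem lintegral_gradient_le_bvSeminorm {W : Set (Rd d)} (hW : IsOpen W) {w : Rd d → ℝ}
    (hw : ContDiff ℝ ∞ w) : ∫⁻ x in W, ‖gradient w x‖ₑ ≤ bvSeminorm W w := by
  have hGc := (contDiff_gradient hw).continuous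
  -- Exhaust `W` by increasing compact sets, with a cutoff equal to 1 on each, and pass to the limit
  -- by monotone convergence.
  obtain ⟨F, hFc, hFW, hFU, hFm⟩ := hW.exists_iUnion_isClosed
  set K : ℕ → Set (Rd d) := fun n => F n ∩ Metric.closedBall 0 n
  have hKm : Monotone K := fun m n hmn => inter_subset_inter (hFm hmn)
    (Metric.closedBall_subset_closedBall (by exact_mod_cast hmn))
  have hKU : ⋃ n, K n = W := by
    refine subset_antisymm (iUnion_subset fun n => inter_subset_left.trans (hFW n)) fun x hx => ?_
    rw [← hFU] at hx
    obtain ⟨n, hn⟩ := mem_iUnion.1 hx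
    obtain ⟨m, hm⟩ := exists_nat_ge ‖x‖
    refine mem_iUnion.2 ⟨max n m, hFm (le_max_left _ _) hn, ?_⟩
    rw [mem_closedBall_zero_iff]
    exact hm.trans (by exact_mod_cast le_max_right n m)
  rw [← hKU, setLIntegral_iUnion_of_directed _ hKm.directed_le, hKU]
  refine iSup_le fun n => ?_
  have hK : IsCompact (K n) := (isCompact_closedBall _ _).inter_left (hFc n)
  obtain ⟨χ, hχ, hc, hs, h01, h1⟩ := exists_smooth_cutoff hK hW (inter_subset_left.trans (hFW n))
  refine le_trans ?_ (ofReal_integral_cutoff_le_bvSeminorm hw hχ hc hs h01)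
  have hi : Integrable (fun x => χ x * ‖gradient w x‖) :=
    (hχ.continuous.mul hGc.norm).integrable_of_hasCompactSupport hc.mul_right
  rw [ofReal_integral_eq_lintegral_ofReal hi
    (Eventually.of_forall fun x => mul_nonneg (h01 x).1 (norm_nonneg _))]
  refine le_trans ?_ (setLIntegral_le_lintegral (K n) _)
  refine setLIntegral_mono' hK.measurableSet fun x hx => ?_
  rw [h1.self_of_nhdsSet x hx, one_mul, ofReal_norm]

/-- Differences of a smooth function in terms of its gradient. -/
theorem translationEnergy_le_lintegral_gradient {Ω W : Set (Rd d)} (hΩ : MeasurableSet Ω)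
    (hW : MeasurableSet W) {w : Rd d → ℝ} (hw : ContDiff ℝ ∞ w) {δ : ℝ}
    (hΩW : ∀ x ∈ Ω, ∀ k : Rd d, ‖k‖ ≤ δ → x + k ∈ W) {h : Rd d} (hh : ‖h‖ ≤ δ) :
    translationEnergy 1 Ω w h ≤ ∫⁻ x in W, ‖inner ℝ h (gradient w x)‖ₑ ^ (1 : ℝ) := by
  have hGc := (contDiff_gradient hw).continuous
  have hGm : Measurable (gradient w) := hGc.measurable
  have hmeas : AEMeasurable (Function.uncurry fun (x : Rd d) (t : ℝ) =>
      ‖inner ℝ h (gradient w (x + t • h))‖ₑ ^ (1 : ℝ))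
      ((volume.restrict Ω).prod (volume.restrict (Ioc 0 1))) := by
    refine Measurable.aemeasurable ?_
    simp only [Function.uncurry_def]
    fun_prop
  calc translationEnergy 1 Ω w h
      ≤ ∫⁻ x in Ω, ∫⁻ t in Ioc (0 : ℝ) 1, ‖inner ℝ h (gradient w (x + t • h))‖ₑ ^ (1 : ℝ) := by
        refine lintegral_mono_ae (ae_restrict_of_ae ?_)
        filter_upwards [(isWeakGrad_gradient hw).ae_sub_eq_integral hGc.stronglyMeasurable h]
          with x hx
        rw [hx]
        exact enorm_integral_rpow_le le_rfl _
    _ = ∫⁻ t in Ioc (0 : ℝ) 1, ∫⁻ x in Ω, ‖inner ℝ h (gradient w (x + t • h))‖ₑ ^ (1 : ℝ) :=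
        lintegral_lintegral_swap hmeas
    _ ≤ ∫⁻ t in Ioc (0 : ℝ) 1, ∫⁻ x in W, ‖inner ℝ h (gradient w x)‖ₑ ^ (1 : ℝ) := by
        refine setLIntegral_mono' measurableSet_Ioc fun t ht => ?_
        rw [← lintegral_indicator hΩ, ← lintegral_indicator hW,
          ← lintegral_add_right_eq_self (W.indicator _) (t • h)]
        refine lintegral_mono fun x => ?_
        by_cases hx : x ∈ Ω
        · have : x + t • h ∈ W := by
            refine hΩW x hx _ (le_trans ?_ hh)
            rw [norm_smul, Real.norm_eq_abs, abs_of_pos ht.1]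
            exact mul_le_of_le_one_left (norm_nonneg _) ht.2
          rw [indicator_of_mem hx, indicator_of_mem this]
        · rw [indicator_of_notMem hx]
          exact zero_le
    _ = _ := by simp

end Smooth

/-! ### Mollification and the case of bounded variation -/

section BoundedVariation

variable {d : ℕ} {Ω : Set (Rd d)}

open ContinuousLinearMap in
/-- The mollification of a function by a normalized bump function. -/
def mollify (φ : ContDiffBump (0 : Rd d)) (u : Rd d → ℝ) : Rd d → ℝ :=
  convolution (φ.normed volume) u (lsmul ℝ ℝ) volume

theorem contDiff_mollify (φ : ContDiffBump (0 : Rd d)) {u : Rd d → ℝ} (hu : Integrable u) :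
    ContDiff ℝ ∞ (mollify φ u) :=
  φ.hasCompactSupport_normed.contDiff_convolution_left _ φ.contDiff_normed hu.locallyIntegrable

theorem IsTestField.translate {W W' : Set (Rd d)} {ψ : Rd d → Rd d} (hψ : IsTestField W ψ)
    (t : Rd d) (ht : ∀ x ∈ W, x - t ∈ W') : IsTestField W' (fun x => ψ (x + t)) where
  smooth := hψ.smooth.comp (contDiff_id.add contDiff_const)
  compact := hψ.compact.comp_homeomorph (Homeomorph.addRight t)
  support_subset x hx := by
    have h1 : x + t ∈ tsupport ψ :=
      tsupport_comp_subset_preimage ψ (continuous_add_const t) hx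
    simpa using ht _ (hψ.support_subset h1)
  norm_le x := hψ.norm_le _

theorem divergence_translate (ψ : Rd d → Rd d) (t x : Rd d) :
    divergence (fun x => ψ (x + t)) x = divergence ψ (x + t) := by
  simp only [divergence]
  rw [fderiv_comp_add_right]

/-- Mollification does not increase the total variation. -/
theorem bvSeminorm_mollify_le {W W' : Set (Rd d)} (φ : ContDiffBump (0 : Rd d))
    (hWW' : ∀ x ∈ W, ∀ t : Rd d, ‖t‖ ≤ φ.rOut → x + t ∈ W') {u : Rd d → ℝ} (hu : Integrable u) :
    bvSeminorm W (mollify φ u) ≤ bvSeminorm W' u := by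
  rcases eq_or_ne (bvSeminorm W' u) ⊤ with htop | htop
  · rw [htop]
    exact le_top
  refine iSup₂_le fun ψ hψ => ?_
  rw [hψ.setIntegral_eq]
  refine ENNReal.ofReal_le_of_le_toReal ?_
  set ρ := φ.normed (volume : Measure (Rd d))
  have hcont := continuous_divergence hψ.smooth
  obtain ⟨C, hC⟩ := (hasCompactSupport_divergence hψ.compact).exists_bound_of_continuous hcont
  have hI : Integrable (fun z : Rd d × Rd d => (ρ z.2 * u (z.1 - z.2)) * divergence ψ z.1)
      (volume.prod volume) := by
    refine Integrable.mul_bdd (c := C) ?_ (hcont.comp continuous_fst).aestronglyMeasurable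
      (Eventually.of_forall fun z => hC _)
    exact φ.integrable_normed.convolution_integrand (ContinuousLinearMap.lsmul ℝ ℝ) hu
  -- Testing a translate of `u` against `ψ` is testing `u` against a translate of `ψ`, which is
  -- admissible on `W'` whenever `ρ t ≠ 0`; averaging over `t` with total mass 1 preserves the
  -- bound.
  have hbound : ∀ t : Rd d, ρ t * ∫ x, u (x - t) * divergence ψ x ≤
      ρ t * (bvSeminorm W' u).toReal := by
    intro t
    by_cases ht : ρ t = 0
    · simp [ht]
    have htr : ‖t‖ ≤ φ.rOut := by
      have : t ∈ Function.support ρ := ht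
      rw [φ.support_normed_eq, mem_ball_zero_iff] at this
      exact this.le
    have hψt : IsTestField W' (fun x => ψ (x + t)) := hψ.translate t fun x hx => by
      rw [sub_eq_add_neg]
      exact hWW' x hx _ (by rwa [norm_neg])
    refine mul_le_mul_of_nonneg_left ?_ (φ.nonneg_normed t)
    have h1 := le_bvSeminorm u hψt
    rw [hψt.setIntegral_eq] at h1
    simp only [divergence_translate] at h1
    rw [← integral_add_right_eq_self (fun x => u (x - t) * divergence ψ x) t]
    simp only [add_sub_cancel_right]
    exact (ENNReal.ofReal_le_iff_le_toReal htop).1 h1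
  calc ∫ x, mollify φ u x * divergence ψ x
      = ∫ x, ∫ t, (ρ t * u (x - t)) * divergence ψ x := by
        refine integral_congr_ae (Eventually.of_forall fun x => ?_)
        simp only
        rw [integral_mul_const]
        rfl
    _ = ∫ t, ∫ x, (ρ t * u (x - t)) * divergence ψ x := integral_integral_swap hI
    _ = ∫ t, ρ t * ∫ x, u (x - t) * divergence ψ x := by
        simp only [mul_assoc, integral_const_mul]
    _ ≤ ∫ t, ρ t * (bvSeminorm W' u).toReal := by
        refine integral_mono ?_ (φ.integrable_normed.mul_const _) hbound
        have := hI.integral_prod_right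
        simpa only [mul_assoc, integral_const_mul] using this
    _ = (bvSeminorm W' u).toReal := by
        rw [integral_mul_const, φ.integral_normed, one_mul]

theorem exists_mollifiers {δ : ℝ} (hδ : 0 < δ) {u : Rd d → ℝ} (hu : Integrable u) :
    ∃ φ : ℕ → ContDiffBump (0 : Rd d), (∀ n, (φ n).rOut ≤ δ) ∧
      ∀ᵐ x, Tendsto (fun n => mollify (φ n) u x) atTop (𝓝 (u x)) := by
  -- The ratio 2 of outer to inner radius is fixed, as required for a.e. convergence at Lebesgue
  -- points.
  set φ : ℕ → ContDiffBump (0 : Rd d) := fun n =>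
    ⟨δ / (n + 1) / 2, δ / (n + 1), by positivity, half_lt_self (by positivity)⟩
  have hlim : Tendsto (fun n => (φ n).rOut) atTop (𝓝 0) :=
    tendsto_const_div_atTop_nhds_zero_nat δ |>.comp (tendsto_add_atTop_nat 1) |>.congr
      fun n => by simp [φ]
  refine ⟨φ, fun n => ?_, ?_⟩
  · exact div_le_self hδ.le (by linarith [(Nat.cast_nonneg n : (0 : ℝ) ≤ n)])
  · refine ContDiffBump.ae_convolution_tendsto_right_of_locallyIntegrable (K := 2) hlim
      (Eventually.of_forall fun n => le_of_eq ?_) hu.locallyIntegrable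
    simp only [φ]
    ring

/-- The near-diagonal part of the energy of a function of bounded variation. -/
theorem near_energy_le_bvSeminorm {e : Rd d} (he : ‖e‖ = 1) {ν : ℝ → Rd d → ℝ≥0∞}
    (hν : IsPLevyApprox 1 ν) {W W' : Set (Rd d)} (hΩ : MeasurableSet Ω) (hW : IsOpen W) {δ : ℝ}
    (hδ : 0 < δ) (hδ1 : δ ≤ 1) (hΩW : ∀ x ∈ Ω, ∀ k : Rd d, ‖k‖ ≤ δ → x + k ∈ W)
    (hWW' : ∀ x ∈ W, ∀ k : Rd d, ‖k‖ ≤ δ → x + k ∈ W') {v : Rd d → ℝ} (hv : Integrable v)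
    {ε : ℝ} (hε : 0 < ε) :
    ∫⁻ h in {h : Rd d | ‖h‖ ≤ δ}, ν ε h * translationEnergy 1 Ω v h ≤
      sphereMean e 1 * bvSeminorm W' v := by
  obtain ⟨φ, hφδ, hφ⟩ := exists_mollifiers hδ hv
  set w : ℕ → Rd d → ℝ := fun n => mollify (φ n) v
  have hw : ∀ n, ContDiff ℝ ∞ (w n) := fun n => contDiff_mollify (φ n) hv
  have hwm : ∀ n, Measurable (w n) := fun n => (hw n).continuous.measurable
  have hms : MeasurableSet {h : Rd d | ‖h‖ ≤ δ} := measurableSet_le measurable_norm measurable_const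
  have hA : ∀ n, Measurable (translationEnergy 1 Ω (w n)) := by
    intro n
    refine Measurable.lintegral_prod_right
      (f := fun h x : Rd d => ‖w n (x + h) - w n x‖ₑ ^ (1 : ℝ)) ?_
    simp only [Function.uncurry_def]
    have := hwm n
    fun_prop
  have hfatou : ∀ h, translationEnergy 1 Ω v h ≤
      liminf (fun n => translationEnergy 1 Ω (w n) h) atTop := by
    intro h
    have hφh : ∀ᵐ x, Tendsto (fun n => w n (x + h)) atTop (𝓝 (v (x + h))) :=
      (measurePreserving_add_right (volume : Measure (Rd d)) h).quasiMeasurePreserving.ae hφ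
    calc translationEnergy 1 Ω v h
        = ∫⁻ x in Ω, liminf (fun n => ‖w n (x + h) - w n x‖ₑ ^ (1 : ℝ)) atTop := by
          refine lintegral_congr_ae (ae_restrict_of_ae ?_)
          filter_upwards [hφ, hφh] with x hx hxh
          exact ((ENNReal.continuous_rpow_const.tendsto _).comp
            (hxh.sub hx).enorm).liminf_eq.symm
      _ ≤ _ := lintegral_liminf_le fun n => by
          have := hwm n
          fun_prop
  have hn : ∀ n, ∫⁻ h in {h : Rd d | ‖h‖ ≤ δ}, ν ε h * translationEnergy 1 Ω (w n) h ≤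
      sphereMean e 1 * bvSeminorm W' v := by
    intro n
    have hGm : Measurable (gradient (w n)) := (contDiff_gradient (hw n)).continuous.measurable
    calc ∫⁻ h in {h : Rd d | ‖h‖ ≤ δ}, ν ε h * translationEnergy 1 Ω (w n) h
        ≤ ∫⁻ h in {h : Rd d | ‖h‖ ≤ δ},
            ν ε h * ∫⁻ x in W, ‖inner ℝ h (gradient (w n) x)‖ₑ ^ (1 : ℝ) := by
          refine setLIntegral_mono' hms fun h hh => ?_
          gcongr
          exact translationEnergy_le_lintegral_gradient hΩ hW.measurableSet (hw n) hΩW hh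
      _ ≤ sphereMean e 1 * ∫⁻ x in W, ‖gradient (w n) x‖ₑ ^ (1 : ℝ) :=
          hν.lintegral_inner_le one_pos he hε hδ1 hGm.aemeasurable
      _ ≤ sphereMean e 1 * bvSeminorm W' v := by
          gcongr
          simp only [ENNReal.rpow_one]
          exact (lintegral_gradient_le_bvSeminorm hW (hw n)).trans (bvSeminorm_mollify_le (φ n)
            (fun x hx t ht => hWW' x hx t (ht.trans (hφδ n))) hv)
  -- A second use of Fatou, now in `h`, transfers the bound `hn` from the mollifications to `v`.
  calc ∫⁻ h in {h : Rd d | ‖h‖ ≤ δ}, ν ε h * translationEnergy 1 Ω v h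
      ≤ ∫⁻ h in {h : Rd d | ‖h‖ ≤ δ},
          liminf (fun n => ν ε h * translationEnergy 1 Ω (w n) h) atTop := by
        refine lintegral_mono fun h => (mul_le_mul_right (hfatou h) _).trans ?_
        have := ENNReal.le_liminf_mul (u := fun _ : ℕ => ν ε h)
          (v := fun n => translationEnergy 1 Ω (w n) h) (f := atTop)
        rw [liminf_const] at this
        exact this
    _ ≤ liminf (fun n => ∫⁻ h in {h : Rd d | ‖h‖ ≤ δ}, ν ε h * translationEnergy 1 Ω (w n) h)
          atTop := lintegral_liminf_le' fun n =>
        (hν.measurable ε hε).restrict.mul (hA n).aemeasurable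
    _ ≤ liminf (fun _ : ℕ => sphereMean e 1 * bvSeminorm W' v) atTop :=
        liminf_le_liminf (Eventually.of_forall hn)
    _ = _ := liminf_const _

theorem add_mem_thickening {r s : ℝ} {x k : Rd d} (hx : x ∈ Metric.thickening r Ω)
    (hk : ‖k‖ ≤ s) : x + k ∈ Metric.thickening (s + r) Ω := by
  obtain ⟨y, hy, hxy⟩ := Metric.mem_thickening_iff.1 hx
  refine Metric.mem_thickening_iff.2 ⟨y, hy, ?_⟩
  calc dist (x + k) y ≤ dist (x + k) x + dist x y := dist_triangle _ _ _
    _ < s + r := by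
      rw [dist_self_add_left]
      linarith

/-- The limit superior for functions of bounded variation on `ℝ^d`. -/
theorem limsup_nonlocalEnergy_le_variation {e : Rd d} (he : ‖e‖ = 1) {ν : ℝ → Rd d → ℝ≥0∞}
    (hν : IsPLevyApprox 1 ν) (hΩ : IsOpen Ω) {v : Rd d → ℝ} (hvm : Measurable v)
    (hv : Integrable v) (hfin : bvSeminorm univ v ≠ ⊤)
    (hbd : variationMeasure v (frontier Ω) = 0) :
    limsup (fun ε : ℝ => nonlocalEnergy 1 (ν ε) Ω v) (𝓝[>] 0) ≤
      sphereMean e 1 * bvSeminorm Ω v := by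
  have hlim : Tendsto (fun η : ℝ≥0∞ => sphereMean e 1 * (bvSeminorm Ω v + η)) (𝓝[>] 0)
      (𝓝 (sphereMean e 1 * (bvSeminorm Ω v + 0))) := by
    refine Tendsto.mono_left ?_ nhdsWithin_le_nhds
    refine ENNReal.Tendsto.const_mul (tendsto_const_nhds.add tendsto_id) (Or.inr ?_)
    -- Finiteness of the constant makes multiplication by it continuous, so $\eta\to0$ can be taken
    -- inside.
    have hle : sphereMean e 1 ≤ 1 := by
      have := nontrivial_Rd he
      have : NeZero (volume : Measure (Rd d)).toSphere := ⟨Measure.toSphere_ne_zero _⟩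
      have hfm := laverage_const (volume : Measure (Rd d)).toSphere (1 : ℝ≥0∞)
      rw [← hfm, sphereMean, laverage_eq, laverage_eq]
      gcongr with w
      rw [ENNReal.rpow_one, ← ofReal_norm, ENNReal.ofReal_le_one]
      refine (norm_inner_le_norm _ _).trans_eq ?_
      simp [he]
    exact (hle.trans_lt ENNReal.one_lt_top).ne
  rw [add_zero] at hlim
  refine ge_of_tendsto hlim ?_
  filter_upwards [self_mem_nhdsWithin] with η hη
  obtain ⟨δ, hδ, hδη⟩ := exists_bvSeminorm_thickening_le hΩ hv hfin hbd (ne_of_gt hη)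
  have hvp : ∫⁻ x, ‖v x‖ₑ ^ (1 : ℝ) ≠ ⊤ := by
    simpa using hv.2.ne
  -- Three steps of size `r` fit into `δ`: one to place $\Omega$ in an open thickening, one for the
  -- translation, one for the mollification. The cap 1 is for the normalization of the kernel.
  set r := min (δ / 3) 1
  have hr : 0 < r := by positivity
  have hr3 : r + (r + r) ≤ δ := by
    have : r ≤ δ / 3 := min_le_left _ _
    linarith
  refine limsup_nonlocalEnergy_le le_rfl hν hvm hvp hr fun ε hε => ?_
  refine (near_energy_le_bvSeminorm he hν hΩ.measurableSet (W := Metric.thickening (r + r) Ω)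
    (W' := Metric.thickening δ Ω) Metric.isOpen_thickening hr (min_le_right _ _)
    (fun x hx k hk => add_mem_thickening (Metric.self_subset_thickening hr _ hx) hk)
    (fun x hx k hk => Metric.thickening_mono hr3 _ (add_mem_thickening hx hk)) hv hε).trans ?_
  gcongr

/-- If the variation is finite, $u$ extends, and neither the energy nor the variation on $\Omega$
changes when $u$ is replaced by its extension. -/
theorem limsup_nonlocalEnergy_le_of_extension {e : Rd d} (he : ‖e‖ = 1) {ν : ℝ → Rd d → ℝ≥0∞}
    (hν : IsPLevyApprox 1 ν) (hΩ : IsBVExtensionDomain Ω) {u : Rd d → ℝ}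
    (hu : MemLp u 1 (volume.restrict Ω)) :
    limsup (fun ε : ℝ => nonlocalEnergy 1 (ν ε) Ω u) (𝓝[>] 0) ≤
      sphereMean e 1 * bvSeminorm Ω u := by
  obtain ⟨hopen, T, C, hT⟩ := hΩ
  rcases eq_or_ne (bvSeminorm Ω u) ⊤ with htop | htop
  · rw [htop, ENNReal.mul_top (sphereMean_ne_zero he one_pos)]
    exact le_top
  have hU : bvSeminorm Ω (hu.toLp u) < ⊤ := by
    rw [bvSeminorm_congr hu.coeFn_toLp]
    exact lt_top_iff_ne_top.2 htop
  obtain ⟨hTu, -, hbd⟩ := hT ⟨hu.toLp u, hU⟩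
  set V := (T ⟨hu.toLp u, hU⟩).1
  have huv : u =ᵐ[volume.restrict Ω] V := hu.coeFn_toLp.symm.trans hTu.symm
  have hfin : bvSeminorm univ V < ⊤ := (T ⟨hu.toLp u, hU⟩).2
  have hV : Integrable V (volume : Measure (Rd d)) := by
    have := memLp_one_iff_integrable.1 (Lp.memLp V)
    simpa only [Measure.restrict_univ] using this
  simp only [nonlocalEnergy_congr _ huv, bvSeminorm_congr huv]
  exact limsup_nonlocalEnergy_le_variation he hν hopen (Lp.stronglyMeasurable V).measurable hV
    hfin.ne hbd

end BoundedVariation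

end BBM

end

theorem mainTheorem4 {d : ℕ} (hd : 1 ≤ d) (e : BBM.Rd d) (he : ‖e‖ = 1)
    (Ω : Set (BBM.Rd d)) (ν : ℝ → BBM.Rd d → ℝ≥0∞) :
    (∀ p : ℝ, 1 ≤ p → BBM.IsPLevyApprox p ν → BBM.IsW1pExtensionDomain p Ω →
      ∀ u : BBM.Rd d → ℝ,
        (1 < p ∧ MemLp u (ENNReal.ofReal p) (volume.restrict Ω)) ∨ (p = 1 ∧ BBM.MemW1p 1 Ω u) →
        limsup (fun ε : ℝ => BBM.nonlocalEnergy p (ν ε) Ω u) (𝓝[>] 0)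
          ≤ BBM.sphereMean e p * BBM.gradEnergy p Ω u) ∧
    (BBM.IsPLevyApprox 1 ν → BBM.IsBVExtensionDomain Ω →
      ∀ u : BBM.Rd d → ℝ, MemLp u 1 (volume.restrict Ω) →
        limsup (fun ε : ℝ => BBM.nonlocalEnergy 1 (ν ε) Ω u) (𝓝[>] 0)
          ≤ BBM.sphereMean e 1 * BBM.bvSeminorm Ω u) := by
  refine ⟨fun p hp hν hΩ u hu => ?_, fun hν hΩ u hu =>
    BBM.limsup_nonlocalEnergy_le_of_extension he hν hΩ hu⟩
  refine BBM.limsup_nonlocalEnergy_le_of_memW1p hp he hν hΩ ?_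
  rcases hu with ⟨-, h⟩ | ⟨rfl, h, -⟩ <;> exact h
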